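/- Let $k$ be a field of characteristic $p>0$ that is finitely generated over $k^p$, let $R=k[x_0,\dots,x_n]$, $\mathfrak m=(x_0,\dots,x_n)$, and let $f\in R$ be homogeneous of degree $d$. For an ideal $I$ of $R$ put $I^{[p^e]}=(u^{p^e}\mid u\in I)$, and let $\tau=\tau(f^{1-1/p})$ be the smallest ideal $\mathfrak a\subseteq R$ with $f^{p-1}\in\mathfrak a^{[p]}$. A ring of characteristic $p$ is F-pure if its Frobenius map is pure. We say that $R/fR$ has an isolated non-F-pure point at $\mathfrak m$ if $(R/fR)_{\mathfrak m}$ is not F-pure but $(R/fR)_{\mathfrak p}$ is F-pure for every prime $\mathfrak p\subsetneq\mathfrak m$. Let $M_e\in\mathbb N\cup\{\infty\}$ be the least degree of a homogeneous element of $(\mathfrak m^{[p^e]}:\tau)\setminus\mathfrak m^{[p^e]}$. (1) Suppose that $R/fR$ has an isolated non-F-pure point at $\mathfrak m$. Then $M_e-(n+1)p^e$ is finite and takes a constant value $\delta(f)\in\mathbb Z$ for all $e\gg0$, and the Frobenius action $$F:H^n_{\mathfrak m}(R/fR)_{<\delta(f)+d}\to H^n_{\mathfrak m}(R/fR)_{<p(\delta(f)+d)}$$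 is injective. The bound is sharp: there is a nonzero $\xi\in H^n_{\mathfrak m}(R/fR)_{\delta(f)+d}$ with $F(\xi)=0$. (2) If $\tau=\mathfrak m^j$ for some $j\ge1$, then $R/fR$ has an isolated non-F-pure point at $\mathfrak m$ and $\delta(f)=-n-j$; in particular $$F:H^n_{\mathfrak m}(R/fR)_{<-n-j+d}\to H^n_{\mathfrak m}(R/fR)_{<p(-n-j+d)}$$ is injective. -/

import Mathlib

open scoped TensorProduct

universe u

noncomputable section

namespace FPureHyp

/-! ### Frobenius and F-purity -/

section FPure

/-- The Frobenius endomorphism `a ↦ a ^ p` of a commutative ring in which the prime `p` is zero.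
(The zero ring is allowed; localizations below may vanish.) -/
def frob (p : ℕ) [hp : Fact p.Prime] (A : Type*) [CommRing A] (hA : (p : A) = 0) : A →+* A where
  toFun a := a ^ p
  map_one' := one_pow p
  map_mul' a b := mul_pow a b p
  map_zero' := zero_pow hp.out.ne_zero
  map_add' a b := by
    obtain ⟨r, hr⟩ := exists_add_pow_prime_eq hp.out a b
    rw [hr, hA]; ring

/-- A ring homomorphism `φ : A → B` is pure if `M → B ⊗[A] M`, `m ↦ 1 ⊗ m`, is injective for
every `A`-module `M`. -/
def IsPure {A B : Type u} [CommRing A] [CommRing B] (φ : A →+* B) : Prop :=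
  letI : Algebra A B := φ.toAlgebra
  ∀ (M : Type u) [AddCommGroup M] [Module A M],
    Function.Injective fun m : M => (1 : B) ⊗ₜ[A] m

/-- A ring `A` in which the prime `p` is zero is F-pure if its Frobenius map is pure. -/
def IsFPure (p : ℕ) [Fact p.Prime] (A : Type u) [CommRing A] : Prop :=
  ∃ hA : (p : A) = 0, IsPure (frob p A hA)

end FPure

/-! ### Čech (local) cohomology of a ring with respect to a finite sequence of elements

For a sequence `x₀, …, x_{m-1}` in `A` we use the Čech complex
`0 → A → ∏ A_{x_i} → ∏ A_{x_i x_j} → ⋯ → A_{x₀ ⋯ x_{m-1}} → 0`, whose cohomology is the local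
cohomology of `A` with support in the ideal generated by the `x_i` (for `A` Noetherian). -/

section Cech

variable {A : Type*} [CommRing A] {m : ℕ} (x : Fin m → A)

/-- `A_I`, the ring `A` with `∏_{i ∈ I} x_i` inverted. -/
abbrev Loc (I : Finset (Fin m)) : Type _ := Localization.Away (∏ i ∈ I, x i)

/-- The canonical map `A_I → A_J` for `I ⊆ J`. -/
def res {I J : Finset (Fin m)} (h : I ⊆ J) : Loc x I →+* Loc x J :=
  IsLocalization.Away.lift (S := Loc x I) (g := algebraMap A (Loc x J)) (∏ i ∈ I, x i)
    (isUnit_of_dvd_unit (map_dvd _ (Finset.prod_dvd_prod_of_subset I J x h))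
      (IsLocalization.Away.algebraMap_isUnit (∏ i ∈ J, x i)))

lemma res_algebraMap {I J : Finset (Fin m)} (h : I ⊆ J) (a : A) :
    res x h (algebraMap A (Loc x I) a) = algebraMap A (Loc x J) a :=
  IsLocalization.Away.lift_eq _ _ a

lemma res_smul {I J : Finset (Fin m)} (h : I ⊆ J) (a : A) (c : Loc x I) :
    res x h (a • c) = a • res x h c := by
  rw [Algebra.smul_def, Algebra.smul_def, map_mul, res_algebraMap]

/-- Čech cochains of degree `q`: families of elements of the `A_I` with `|I| = q`. -/
abbrev Cochain (q : ℕ) : Type _ := (I : {I : Finset (Fin m) // I.card = q}) → Loc x I.1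

/-- The Čech differential: the component of `d c` at `J` is the sum over `j ∈ J` of the restrictions
of `c_{J \ {j}}`, with sign `(-1)` to the power of the position of `j` in `J`. -/
def diff (q : ℕ) : Cochain x q →ₗ[A] Cochain x (q + 1) where
  toFun c J := ∑ j : {j // j ∈ J.1}, (-1) ^ (J.1.filter (· < j.1)).card *
    res x (Finset.erase_subset j.1 J.1)
      (c ⟨J.1.erase j.1, by rw [Finset.card_erase_of_mem j.2, J.2]; rfl⟩)
  map_add' c c' := by
    funext J
    simp only [Pi.add_apply, map_add, mul_add, Finset.sum_add_distrib]
  map_smul' a c := by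
    funext J
    simp only [Pi.smul_apply, res_smul, RingHom.id_apply, Finset.smul_sum, mul_smul_comm]

/-- Cocycles of degree `q`. -/
def cocycles (q : ℕ) : Submodule A (Cochain x q) := LinearMap.ker (diff x q)

/-- Coboundaries of degree `q`. -/
def coboundaries : (q : ℕ) → Submodule A (Cochain x q)
  | 0 => ⊥
  | q + 1 => LinearMap.range (diff x q)

/-- The `q`-th Čech cohomology `H^q` of `A` with respect to the sequence `x`. -/
abbrev Cohomology (q : ℕ) : Type _ :=
  cocycles x q ⧸ (coboundaries x q).submoduleOf (cocycles x q)

/-! The Frobenius action. -/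

lemma natCast_loc (p : ℕ) (hA : (p : A) = 0) (I : Finset (Fin m)) : (p : Loc x I) = 0 := by
  rw [← map_natCast (algebraMap A (Loc x I)), hA, map_zero]

variable (p : ℕ) [Fact p.Prime]

/-- The Frobenius on cochains: the `p`-th power map on every component. -/
def frobCochain (hA : (p : A) = 0) (q : ℕ) : Cochain x q →ₛₗ[frob p A hA] Cochain x q where
  toFun c I := frob p (Loc x I.1) (natCast_loc x p hA I.1) (c I)
  map_add' c c' := by
    funext I
    simp only [Pi.add_apply, map_add]
  map_smul' a c := by
    funext I
    simp only [Pi.smul_apply, Algebra.smul_def, map_mul]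
    congr 1
    simp [frob]

lemma diff_frobCochain (hA : (p : A) = 0) (q : ℕ) (c : Cochain x q) :
    diff x q (frobCochain x p hA q c) = frobCochain x p hA (q + 1) (diff x q c) := by
  funext J
  simp only [diff, frobCochain, LinearMap.coe_mk, AddHom.coe_mk, map_sum, map_mul, map_pow,
    map_neg, map_one]
  refine Finset.sum_congr rfl fun j _ => ?_
  congr 1
  simp [frob]

lemma frobCochain_mem_cocycles (hA : (p : A) = 0) (q : ℕ) (c : cocycles x q) :
    frobCochain x p hA q c.1 ∈ cocycles x q := by
  have h : diff x q c.1 = 0 := c.2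
  change diff x q _ = 0
  rw [diff_frobCochain, h, map_zero]

lemma frobCochain_mem_coboundaries (hA : (p : A) = 0) (q : ℕ) (c : Cochain x q)
    (hc : c ∈ coboundaries x q) : frobCochain x p hA q c ∈ coboundaries x q := by
  cases q with
  | zero =>
    have h : c = 0 := hc
    rw [h, map_zero]; exact Submodule.zero_mem _
  | succ q =>
    obtain ⟨b, rfl⟩ := hc
    exact ⟨frobCochain x p hA q b, diff_frobCochain x p hA q b⟩

/-- The Frobenius on cocycles. -/
def frobCocycles (hA : (p : A) = 0) (q : ℕ) : cocycles x q →ₛₗ[frob p A hA] cocycles x q :=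
  ((frobCochain x p hA q).comp (cocycles x q).subtype).codRestrict (cocycles x q)
    (frobCochain_mem_cocycles x p hA q)

/-- The Frobenius action `F : H^q → H^q`, induced by the `p`-th power map on cochains. -/
def frobCohomology (hA : (p : A) = 0) (q : ℕ) :
    Cohomology x q →ₛₗ[frob p A hA] Cohomology x q :=
  Submodule.mapQ _ _ (frobCocycles x p hA q) fun c hc =>
    frobCochain_mem_coboundaries x p hA q c.1 hc

/-! The grading, for a grading `𝒜` of `A` in which all the `x_i` have degree one. -/

variable (𝒜 : ℕ → AddSubgroup A)

/-- The degree `j` part of `A_I`: it is generated by the fractions `a / (∏_{i ∈ I} x_i) ^ N`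
with `a` homogeneous of degree `j + N |I|`. -/
def locDegree (j : ℤ) (I : Finset (Fin m)) : AddSubgroup (Loc x I) :=
  AddSubgroup.closure {c | ∃ (N r : ℕ) (a : A), a ∈ 𝒜 r ∧ (r : ℤ) = j + N * I.card ∧
    c = Localization.mk a ⟨(∏ i ∈ I, x i) ^ N, pow_mem (Submonoid.mem_powers _) N⟩}

/-- The degree `j` part of `H^q`: the classes of cocycles with all components of degree `j`. -/
def cohomologyDegree (q : ℕ) (j : ℤ) : AddSubgroup (Cohomology x q) :=
  AddSubgroup.map
    (Submodule.mkQ ((coboundaries x q).submoduleOf (cocycles x q))).toAddMonoidHom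
    { carrier := {c | ∀ I, c.1 I ∈ locDegree x 𝒜 j I.1}
      zero_mem' := fun _ => AddSubgroup.zero_mem _
      add_mem' := fun ha hb I => AddSubgroup.add_mem _ (ha I) (hb I)
      neg_mem' := fun ha I => AddSubgroup.neg_mem _ (ha I) }

/-- `H^q_{< N}`, the sum of the parts of `H^q` of degree less than `N`. -/
def cohomologyLT (q : ℕ) (N : ℤ) : AddSubgroup (Cohomology x q) :=
  ⨆ j : {j : ℤ // j < N}, cohomologyDegree x 𝒜 q j.1

end Cech

/-! ### Hypersurfaces `R/fR`, where `R = k[x₀, …, xₙ]` -/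

section Hypersurface

variable {k : Type u} [Field k] {n : ℕ}

/-- `R = k[x₀, …, xₙ]`. -/
abbrev Poly (k : Type u) [Field k] (n : ℕ) : Type u := MvPolynomial (Fin (n + 1)) k

/-- The homogeneous maximal ideal `𝔪 = (x₀, …, xₙ)` of `R`. -/
def maxIdeal (k : Type u) [Field k] (n : ℕ) : Ideal (Poly k n) :=
  Ideal.span (Set.range MvPolynomial.X)

instance maxIdeal_isPrime : (maxIdeal k n).IsPrime := by
  have h : maxIdeal k n = RingHom.ker (MvPolynomial.constantCoeff (R := k)) := by
    ext g
    rw [maxIdeal, ← Set.image_univ, MvPolynomial.mem_ideal_span_X_image, RingHom.mem_ker,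
      MvPolynomial.constantCoeff_eq]
    constructor
    · intro hg
      by_contra h0
      obtain ⟨i, -, hi⟩ := hg 0 (MvPolynomial.mem_support_iff.mpr h0)
      exact hi rfl
    · intro hg s hs
      by_contra! h
      have h0 : s = 0 := Finsupp.ext fun i => h i (Set.mem_univ i)
      rw [h0] at hs
      exact MvPolynomial.mem_support_iff.mp hs hg
  rw [h]; exact RingHom.ker_isPrime _

/-- The Frobenius power `I^{[p^e]}`, generated by the `u ^ (p ^ e)` with `u ∈ I`. -/
def frobPower {R : Type*} [CommRing R] (p : ℕ) (I : Ideal R) (e : ℕ) : Ideal R :=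
  Ideal.span ((fun u => u ^ p ^ e) '' (I : Set R))

/-- The test ideal `τ(f^{1 - 1/p^e})`: the smallest ideal `𝔞` with `f ^ (p ^ e - 1) ∈ 𝔞^{[p^e]}`. -/
def testIdeal (p : ℕ) (f : Poly k n) (e : ℕ) : Ideal (Poly k n) :=
  sInf {𝔞 | f ^ (p ^ e - 1) ∈ frobPower p 𝔞 e}

/-- The hypersurface ring `R/fR`. -/
abbrev Hyp (f : Poly k n) : Type u := Poly k n ⧸ Ideal.span {f}

/-- The localization `(R/fR)_P` at a prime ideal `P` of `R` (the zero ring if `f ∉ P`). -/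
abbrev HypLoc (f : Poly k n) (P : Ideal (Poly k n)) [P.IsPrime] : Type u :=
  Localization (P.primeCompl.map (Ideal.Quotient.mk (Ideal.span {f})))

/-- `R/fR` has an isolated non-F-pure point at `𝔪`: `(R/fR)_𝔪` is not F-pure, but `(R/fR)_P` is
for every prime `P ⊊ 𝔪`. -/
def IsolatedNonFPure (p : ℕ) [Fact p.Prime] (f : Poly k n) : Prop :=
  ¬ IsFPure p (HypLoc f (maxIdeal k n)) ∧
    ∀ (P : Ideal (Poly k n)) [P.IsPrime], P < maxIdeal k n → IsFPure p (HypLoc f P)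

/-- `M_e`, the least degree of a homogeneous element of `(𝔪^{[p^e]} : τ(f^{1 - 1/p}))` outside
`𝔪^{[p^e]}`, and `∞` if there is none. -/
def minDeg (p : ℕ) (f : Poly k n) (e : ℕ) : ℕ∞ :=
  sInf {r : ℕ∞ | ∃ (s : ℕ) (g : Poly k n), g.IsHomogeneous s ∧
    g ∈ (frobPower p (maxIdeal k n) e).colon (testIdeal p f 1 : Set (Poly k n)) ∧
    g ∉ frobPower p (maxIdeal k n) e ∧ r = s}

/-- `δ` is the stable value of the sequence `M_e - (n + 1) p ^ e`, that is, `M_e` is finite and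
`M_e - (n + 1) p ^ e = δ` for all sufficiently large `e`. -/
def IsDelta (p : ℕ) (f : Poly k n) (δ : ℤ) : Prop :=
  ∀ᶠ e : ℕ in Filter.atTop, ∃ M : ℕ, minDeg p f e = M ∧ (M : ℤ) - (n + 1) * p ^ e = δ

/-- The images of `x₀, …, xₙ` in `R/fR`. -/
def hypVar (f : Poly k n) (i : Fin (n + 1)) : Hyp f :=
  Ideal.Quotient.mk (Ideal.span {f}) (MvPolynomial.X i)

/-- The degree `r` part of `R/fR`, for `f` homogeneous. -/
def hypGrading (f : Poly k n) (r : ℕ) : AddSubgroup (Hyp f) :=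
  AddSubgroup.map (Ideal.Quotient.mk (Ideal.span {f})).toAddMonoidHom
    (MvPolynomial.homogeneousSubmodule (Fin (n + 1)) k r).toAddSubgroup

/-- The local cohomology module `H^q_𝔪(R/fR)`. -/
abbrev HypLC (f : Poly k n) (q : ℕ) : Type u := Cohomology (hypVar f) q

/-- `H^q_𝔪(R/fR)_j`. -/
abbrev hypLCDegree (f : Poly k n) (q : ℕ) (j : ℤ) : AddSubgroup (HypLC f q) :=
  cohomologyDegree (hypVar f) (hypGrading f) q j

/-- `H^q_𝔪(R/fR)_{< N}`. -/
abbrev hypLCLT (f : Poly k n) (q : ℕ) (N : ℤ) : AddSubgroup (HypLC f q) :=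
  cohomologyLT (hypVar f) (hypGrading f) q N

lemma natCast_hyp (p : ℕ) [CharP k p] (f : Poly k n) : (p : Hyp f) = 0 := by
  rw [← map_natCast (algebraMap k (Hyp f)), CharP.cast_eq_zero, map_zero]

/-- The Frobenius action on `H^q_𝔪(R/fR)`. -/
def hypFrob (p : ℕ) [Fact p.Prime] [CharP k p] (f : Poly k n) (q : ℕ) (ξ : HypLC f q) :
    HypLC f q :=
  frobCohomology (hypVar f) p (natCast_hyp p f) q ξ

end Hypersurface

end FPureHyp

end

noncomputable section

namespace FPureHyp

/-! Multiplication by `f` gives `0 → R → R → R/fR → 0`. Since `H^n_𝔪(R) = 0`, the connecting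
homomorphism embeds `H^n_𝔪(R/fR)` into `H^{n+1}_𝔪(R)` as the annihilator of `f`, lowering degrees by
`d`. There Frobenius becomes `η ↦ f^{p-1} F(η)` (`IsConnecting.eq_zero_iff`,
`IsConnecting.hypFrob`).

An element of `H^{n+1}_𝔪(R)` is a fraction `g / (x₀ ⋯ xₙ)^q` with `q = p^e`. It vanishes exactly
when `g ∈ 𝔪^{[q]}`, and its degree is `deg g - (n+1) q`. Because `f^{p-1} g^p ∈ 𝔪^{[pq]}` if and
only if `g τ ⊆ 𝔪^{[q]}` (`FrobCoord.pow_mul_pow_mem_iff`), the kernel of Frobenius is the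
annihilator of `τ`, and `M_e - (n+1) p^e` is the least degree visible in it with denominator
exponent `q`. Enlarging `e` multiplies `g` by a power of `x₀ ⋯ xₙ` and keeps this difference. The
minima therefore stabilize as soon as the differences are bounded below, and the stable value is the
lowest degree of the kernel, which gives both injectivity and sharpness.

The bound comes from Fedder's criterion: for `f ≠ 0`, `(R/fR)_P` is F-pure if and only if `τ ⊄ P`
(`FrobCoord.isFPure_hypLoc_iff`). An isolated non-F-pure point thus means that `τ ⊆ 𝔪` and that no
prime strictly below `𝔪` contains `τ`. As `τ` is homogeneous, it contains some `𝔪^N`, and a nonzero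
element killed by `𝔪^N` has degree at least `-n-N`. For `τ = 𝔪^j` the bound `-n-j` is attained by a
monomial.

Two devices make this explicit. Since `k` is finite over `k^p`, membership in `J^{[p]}` is tested by
finitely many `p⁻¹`-linear coordinates (`FrobCoord.mem_frobPower_iff`). Čech cochains of `R` are
families of Laurent polynomials, whose cocycles are integrated monomial by monomial
(`exists_altDiff_eq`). -/

/-- Coordinates expressing every element of `R` as a combination of finitely many elements `e i`
with `p`-th powers as coefficients, `p⁻¹`-linearly. -/
structure FrobCoord (p : ℕ) (R : Type*) [CommRing R] (ι : Type*) [Fintype ι] where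
  e : ι → R
  coord : ι → R →+ R
  coord_pow_mul : ∀ i a b, coord i (a ^ p * b) = a * coord i b
  sum_eq : ∀ b, ∑ i, coord i b ^ p * e i = b

/-! ### Frobenius coordinates and Frobenius powers of ideals -/

section FrobCoord

variable {p : ℕ} {R : Type*} [CommRing R] {ι : Type*} [Fintype ι] (B : FrobCoord p R ι)
include B

lemma FrobCoord.coord_mul_pow (i : ι) (a b : R) : B.coord i (b * a ^ p) = a * B.coord i b := by
  rw [mul_comm, B.coord_pow_mul]

/-- By `p⁻¹`-linearity, coordinates carry multiples of `u ^ p` to multiples of `u`; conversely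
`sum_eq` writes `b` as a combination of `p`-th powers of its coordinates. -/
lemma FrobCoord.mem_frobPower_iff (J : Ideal R) (b : R) :
    b ∈ frobPower p J 1 ↔ ∀ i, B.coord i b ∈ J := by
  constructor
  · intro h i
    -- Coordinates are not `R`-linear, so the induction claim needs an arbitrary multiplier `r` to
    -- be stable under scalars.
    refine Submodule.span_induction (p := fun b _ => ∀ r, B.coord i (r * b) ∈ J)
      ?_ ?_ ?_ ?_ h 1 |> fun h => by simpa using h
    · rintro _ ⟨u, hu, rfl⟩ r
      simp only [pow_one]
      rw [B.coord_mul_pow]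
      exact J.mul_mem_right _ hu
    · intro r; simp
    · intro x y _ _ hx hy r
      rw [mul_add, map_add]
      exact J.add_mem (hx r) (hy r)
    · intro a x _ hx r
      rw [smul_eq_mul, ← mul_assoc]
      exact hx _
  · intro h
    rw [← B.sum_eq b]
    refine Ideal.sum_mem _ fun i _ => Ideal.mul_mem_right _ _ ?_
    exact Ideal.subset_span ⟨B.coord i b, h i, by simp⟩

lemma FrobCoord.span_coord_one [hp : Fact p.Prime] :
    Ideal.span (Set.range fun i => B.coord i 1) = ⊤ := by
  rw [Ideal.eq_top_iff_one]
  suffices h : ∑ i, B.coord i 1 ^ p * B.e i ∈ Ideal.span (Set.range fun i => B.coord i 1) by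
    rwa [B.sum_eq] at h
  refine Ideal.sum_mem _ fun i _ => Ideal.mul_mem_right _ _ ?_
  exact Ideal.pow_mem_of_mem _ (Ideal.subset_span (Set.mem_range_self i)) _ hp.out.pos

lemma FrobCoord.exists_coord_one_notMem [hp : Fact p.Prime] (P : Ideal R) [P.IsPrime] :
    ∃ i, B.coord i 1 ∉ P := by
  by_contra! h
  refine Ideal.IsPrime.ne_top (I := P) inferInstance (top_le_iff.mp ?_)
  rw [← B.span_coord_one, Ideal.span_le]
  rintro _ ⟨i, rfl⟩
  exact h i

end FrobCoord

/-- A finite module over a field has a finite family of additive coordinates. -/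
lemma exists_coord_of_finite {A B : Type*} [Field A] [CommRing B] (φ : A →+* B) (h : φ.Finite) :
    ∃ (r : ℕ) (e : Fin r → B) (c : Fin r → B →+ A), (∀ i a b, c i (φ a * b) = a * c i b) ∧
      ∀ b, ∑ i, φ (c i b) * e i = b := by
  let _ := φ.toAlgebra
  have : Module.Finite A B := h
  let v := Module.finBasis A B
  refine ⟨_, v, fun i => (v.coord i).toAddMonoidHom, fun i a b => ?_, fun b => ?_⟩
  · change v.coord i (algebraMap A B a * b) = _
    rw [← Algebra.smul_def, map_smul]; rfl
  · conv_rhs => rw [← v.sum_repr b]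
    refine Finset.sum_congr rfl fun i _ => ?_
    rw [Algebra.smul_def]; rfl

/-! ### Frobenius coordinates on polynomial rings -/

section MvPolynomial

open MvPolynomial

variable {p : ℕ} {k : Type*} [Field k] {σ : Type*} {ι : Type*} [Fintype ι]

lemma isHomogeneous_iff_degree {g : MvPolynomial σ k} {D : ℕ} :
    g.IsHomogeneous D ↔ ∀ m, coeff m g ≠ 0 → m.degree = D := by
  simp only [Finsupp.degree_eq_weight_one]
  exact ⟨fun h m hm => h hm, fun h m hm => h m hm⟩

/-- The exponent `p m + a`. -/
def expShift (p : ℕ) (a : σ →₀ ℕ) (m : σ →₀ ℕ) : σ →₀ ℕ := p • m + a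

lemma expShift_injective (hp : p ≠ 0) (a : σ →₀ ℕ) : Function.Injective (expShift p a) := by
  intro m m' h
  ext i
  have := DFunLike.congr_fun h i
  simp only [expShift, Finsupp.add_apply, Finsupp.smul_apply, smul_eq_mul] at this
  exact Nat.eq_of_mul_eq_mul_left (Nat.pos_of_ne_zero hp) (by omega)

/-- The additive map `g ↦ ∑ₘ c(g_{p m + a}) Xᵐ`. -/
def polyCoord (hp : p ≠ 0) (c : k →+ k) (a : σ →₀ ℕ) : MvPolynomial σ k →+ MvPolynomial σ k where
  toFun g := AddMonoidAlgebra.ofCoeff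
    (((AddMonoidAlgebra.coeff g).comapDomain _ (expShift_injective hp a).injOn).mapRange c
      (map_zero c))
  map_zero' := by
    refine MvPolynomial.ext _ _ fun m => ?_
    exact map_zero c
  map_add' x y := by
    refine MvPolynomial.ext _ _ fun m => ?_
    exact map_add c _ _

@[simp] lemma coeff_polyCoord (hp : p ≠ 0) (c : k →+ k) (a : σ →₀ ℕ) (g : MvPolynomial σ k)
    (m : σ →₀ ℕ) : coeff m (polyCoord hp c a g) = c (coeff (p • m + a) g) := rfl

/-- A nonzero coefficient at `m` comes from the exponent `p m + a` of degree `D`, so the subtraction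
and the division are exact whenever they matter. -/
lemma polyCoord_isHomogeneous (hp : p ≠ 0) (c : k →+ k) (a : σ →₀ ℕ) {g : MvPolynomial σ k} {D : ℕ}
    (hg : g.IsHomogeneous D) : (polyCoord hp c a g).IsHomogeneous ((D - a.degree) / p) := by
  rw [isHomogeneous_iff_degree] at hg ⊢
  intro m hm
  rw [coeff_polyCoord] at hm
  have h : coeff (p • m + a) g ≠ 0 := fun h => hm (by rw [h, map_zero])
  rw [← hg _ h, map_add, map_nsmul]
  simp [Nat.pos_of_ne_zero hp]

/-- It suffices to treat a monomial `h = s X^u`. Since all `a i < p`, the exponent `p u` divides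
into `p m + a` exactly when `u ≤ m`. -/
lemma polyCoord_pow_mul [hp : Fact p.Prime] [CharP k p] (c : k →+ k)
    (hc : ∀ a b, c (a ^ p * b) = a * c b) {a : σ →₀ ℕ} (ha : ∀ i, a i < p) (h g : MvPolynomial σ k) :
    polyCoord hp.out.ne_zero c a (h ^ p * g) = h * polyCoord hp.out.ne_zero c a g := by
  classical
  have hp0 := hp.out.ne_zero
  induction h using MvPolynomial.induction_on' generalizing g with
  | add h₁ h₂ ih₁ ih₂ => rw [add_pow_char, add_mul, map_add, ih₁, ih₂, add_mul]
  | monomial u s =>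
    ext m
    rw [coeff_polyCoord, monomial_pow, coeff_monomial_mul', coeff_monomial_mul', coeff_polyCoord]
    by_cases hum : u ≤ m
    · rw [if_pos hum, if_pos, hc]
      · congr 3
        ext i
        have := hum i
        simp only [Finsupp.coe_tsub, Finsupp.coe_add, Finsupp.coe_smul, Pi.sub_apply, Pi.add_apply,
          Pi.smul_apply, smul_eq_mul, Nat.mul_sub]
        have := Nat.mul_le_mul_left p this
        omega
      · intro i
        have := Nat.mul_le_mul_left p (hum i)
        simp only [Finsupp.coe_add, Finsupp.coe_smul, Pi.add_apply, Pi.smul_apply, smul_eq_mul]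
        omega
    · rw [if_neg hum, if_neg, map_zero]
      intro hle
      refine hum fun i => ?_
      have h1 := hle i
      have h2 := ha i
      simp only [Finsupp.coe_add, Finsupp.coe_smul, Pi.add_apply, Pi.smul_apply, smul_eq_mul] at h1
      by_contra! h3
      have := Nat.mul_le_mul_left p (Nat.succ_le_of_lt h3)
      rw [Nat.mul_succ] at this
      omega

/-- The exponent vector given by a family of remainders modulo `p`. -/
def remExp [Finite σ] (a : σ → Fin p) : σ →₀ ℕ := Finsupp.equivFunOnFinite.symm fun i => (a i : ℕ)

@[simp] lemma remExp_apply [Finite σ] (a : σ → Fin p) (i : σ) : remExp a i = a i := rfl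

/-- Frobenius coordinates on a field induce Frobenius coordinates on polynomial rings. -/
def mvPolyFrobCoord [hp : Fact p.Prime] [CharP k p] [Fintype σ] [DecidableEq σ]
    (B : FrobCoord p k ι) :
    FrobCoord p (MvPolynomial σ k) (ι × (σ → Fin p)) where
  e i := monomial (remExp i.2) (B.e i.1)
  coord i := polyCoord hp.out.ne_zero (B.coord i.1) (remExp i.2)
  coord_pow_mul i g h := polyCoord_pow_mul _ (B.coord_pow_mul i.1) (fun j => (i.2 j).2) g h
  sum_eq b := by
    have hp0 := hp.out.ne_zero
    induction b using MvPolynomial.induction_on' with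
    | add h₁ h₂ ih₁ ih₂ =>
      simp only [map_add, add_pow_char, add_mul, Finset.sum_add_distrib, ih₁, ih₂]
    | monomial u s =>
      -- Division with remainder gives the only decomposition `u = p m₀ + a₀`, so only the
      -- coordinates with remainder `a₀` can be nonzero on this monomial.
      let a₀ : σ → Fin p := fun i => ⟨u i % p, Nat.mod_lt _ hp.out.pos⟩
      let m₀ : σ →₀ ℕ := Finsupp.equivFunOnFinite.symm fun i => u i / p
      have hu : p • m₀ + remExp a₀ = u := by
        ext i
        exact Nat.div_add_mod (u i) p
      have hiff (m : σ →₀ ℕ) (a : σ → Fin p) : u = p • m + remExp a ↔ m = m₀ ∧ a = a₀ := by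
        constructor
        · intro h
          have h' (i : σ) : u i = p * m i + a i := by rw [h]; rfl
          constructor
          · ext i
            change m i = u i / p
            rw [h' i, Nat.mul_add_div hp.out.pos, Nat.div_eq_of_lt (a i).2, add_zero]
          · funext i
            apply Fin.ext
            change (a i : ℕ) = u i % p
            rw [h' i, Nat.mul_add_mod, Nat.mod_eq_of_lt (a i).2]
        · rintro ⟨rfl, rfl⟩
          exact hu.symm
      have hcoord (j : ι) (a : σ → Fin p) : polyCoord hp0 (B.coord j) (remExp a) (monomial u s) =
          if a = a₀ then monomial m₀ (B.coord j s) else 0 := by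
        ext m
        rw [coeff_polyCoord, coeff_monomial, apply_ite (coeff m), coeff_monomial, coeff_zero,
          apply_ite (B.coord j), map_zero]
        simp only [hiff]
        by_cases h1 : a = a₀ <;> by_cases h2 : m = m₀ <;> simp [h1, h2, eq_comm]
      rw [Fintype.sum_prod_type]
      simp only [hcoord]
      have hsum (j : ι) : ∑ a : σ → Fin p, (if a = a₀ then monomial m₀ (B.coord j s) else 0) ^ p *
          monomial (remExp a) (B.e j) = monomial u (B.coord j s ^ p * B.e j) := by
        rw [Finset.sum_eq_single a₀]
        · rw [if_pos rfl, monomial_pow, monomial_mul, hu]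
        · intro a _ ha
          rw [if_neg ha, zero_pow hp0, zero_mul]
        · simp
      simp only [hsum]
      rw [← map_sum, B.sum_eq]

end MvPolynomial

/-- Polynomial rings over `F`-finite fields have Frobenius coordinates preserving homogeneity. -/
lemma exists_frobCoord {k : Type*} [Field k] (p : ℕ) [hp : Fact p.Prime] [CharP k p]
    (hk : (frobenius k p).Finite) (n : ℕ) :
    ∃ (ι : Type) (_ : Fintype ι) (B : FrobCoord p (Poly k n) ι), ∀ i (g : Poly k n) (D : ℕ),
      g.IsHomogeneous D → ∃ D', (B.coord i g).IsHomogeneous D' := by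
  obtain ⟨r, e, c, h1, h2⟩ := exists_coord_of_finite _ hk
  exact ⟨_, inferInstance, mvPolyFrobCoord ⟨e, c, h1, h2⟩, fun i g D hg =>
    ⟨_, polyCoord_isHomogeneous hp.out.ne_zero _ _ hg⟩⟩

/-! ### The test ideal in coordinates -/

section TestIdeal

variable {k : Type u} [Field k] {n p : ℕ} {ι : Type*} [Fintype ι] (B : FrobCoord p (Poly k n) ι)
include B

lemma FrobCoord.testIdeal_eq (f : Poly k n) :
    testIdeal p f 1 = Ideal.span (Set.range fun i => B.coord i (f ^ (p - 1))) := by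
  apply le_antisymm
  · refine sInf_le (Set.mem_ofPred.mpr ?_)
    rw [B.mem_frobPower_iff, pow_one]
    exact fun i => Ideal.subset_span ⟨i, rfl⟩
  · refine le_sInf fun J hJ => ?_
    rw [Set.mem_ofPred, B.mem_frobPower_iff, pow_one] at hJ
    rw [Ideal.span_le]
    rintro _ ⟨i, rfl⟩
    exact hJ i

lemma FrobCoord.coord_mem_testIdeal (f : Poly k n) (i : ι) :
    B.coord i (f ^ (p - 1)) ∈ testIdeal p f 1 := by
  rw [B.testIdeal_eq]
  exact Ideal.subset_span ⟨i, rfl⟩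

lemma FrobCoord.pow_mem_frobPower_testIdeal (f : Poly k n) :
    f ^ (p - 1) ∈ frobPower p (testIdeal p f 1) 1 :=
  (B.mem_frobPower_iff _ _).mpr (B.coord_mem_testIdeal f)

/-- From `f ^ p ∈ τ^{[p]}`, every coordinate `f * coord i 1` of `f ^ p` lies in `τ`, and `1` is a
combination of the `coord i 1`. -/
lemma FrobCoord.self_mem_testIdeal [hp : Fact p.Prime] (f : Poly k n) : f ∈ testIdeal p f 1 := by
  have h : f ^ p ∈ frobPower p (testIdeal p f 1) 1 := by
    rw [← mul_pow_sub_one hp.out.ne_zero]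
    exact Ideal.mul_mem_left _ _ (B.pow_mem_frobPower_testIdeal f)
  rw [B.mem_frobPower_iff] at h
  have hf (i : ι) : f * B.coord i 1 ∈ testIdeal p f 1 := by
    have := h i
    rwa [← mul_one (f ^ p), B.coord_pow_mul] at this
  suffices h1 : f * ∑ i, B.coord i 1 ^ p * B.e i ∈ testIdeal p f 1 by
    rwa [B.sum_eq, mul_one] at h1
  rw [Finset.mul_sum]
  refine Ideal.sum_mem _ fun i _ => ?_
  rw [← mul_pow_sub_one hp.out.ne_zero, ← mul_assoc, ← mul_assoc]
  exact Ideal.mul_mem_right _ _ (Ideal.mul_mem_right _ _ (hf i))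

/-- `f^{p-1} g^p ∈ J^{[p]}` if and only if `g τ ⊆ J`. -/
lemma FrobCoord.pow_mul_pow_mem_iff (f g : Poly k n) (J : Ideal (Poly k n)) :
    f ^ (p - 1) * g ^ p ∈ frobPower p J 1 ↔ g ∈ J.colon (testIdeal p f 1 : Set (Poly k n)) := by
  rw [B.mem_frobPower_iff, Submodule.mem_colon, B.testIdeal_eq]
  simp only [B.coord_mul_pow]
  constructor
  · intro h x hx
    have : Ideal.span (Set.range fun i => B.coord i (f ^ (p - 1))) ≤
        Submodule.comap (LinearMap.mulLeft (Poly k n) g) J := by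
      rw [Ideal.span_le]
      rintro _ ⟨i, rfl⟩
      exact h i
    exact this hx
  · exact fun h i => h _ (Ideal.subset_span ⟨i, rfl⟩)

end TestIdeal

/-! ### Pure ring maps and linear systems -/

section Purity

lemma IsPure.of_retraction {A B : Type u} [CommRing A] [CommRing B] (φ : A →+* B) (ψ : B →+ A)
    (hψ : ∀ a b, ψ (φ a * b) = a * ψ b) (h1 : ψ 1 = 1) : IsPure φ := by
  let _ : Algebra A B := φ.toAlgebra
  intro M _ _ m m' h
  let Ψ : B →ₗ[A] A :=
    { ψ with
      map_smul' := fun a b => by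
        change ψ (a • b) = a * ψ b
        rw [Algebra.smul_def]; exact hψ a b }
  have h' := congrArg (TensorProduct.lid A M ∘ Ψ.rTensor M) h
  have hΨ : Ψ 1 = 1 := h1
  simpa [hΨ] using h'

/-- Pure ring maps reflect the solvability of finite systems of linear equations. -/
lemma IsPure.exists_solution {A B : Type u} [CommRing A] [CommRing B] {φ : A →+* B} (h : IsPure φ)
    {ι κ : Type} [Fintype ι] [Fintype κ] (c : ι → κ → A) (u : ι → A) (e : ι → B)
    (hc : ∀ l, ∑ s, φ (c s l) * e s = 0) (hu : ∑ s, φ (u s) * e s = 1) :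
    ∃ a : ι → A, (∀ l, ∑ s, a s * c s l = 0) ∧ ∑ s, a s * u s = 1 := by
  classical
  let _ : Algebra A B := φ.toAlgebra
  let v : ι → (κ → A) × A := fun s => (c s, u s)
  -- In the quotient by the span of the vectors `(c s, u s)`, the class of `(0, 1)` vanishes exactly
  -- when the system is solvable over `A`. The solution `e` makes it vanish after tensoring with
  -- `B`, and purity descends this.
  let N : Submodule A ((κ → A) × A) := Submodule.span A (Set.range v)
  let q := N.mkQ
  have hv (s : ι) : q (v s) = 0 := by
    rw [Submodule.mkQ_apply, Submodule.Quotient.mk_eq_zero]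
    exact Submodule.subset_span ⟨s, rfl⟩
  have hsplit (s : ι) : q (0, u s) = - ∑ l, c s l • q (Pi.single l 1, 0) := by
    have h1 : v s = (0, u s) + ∑ l, c s l • ((Pi.single l 1, 0) : (κ → A) × A) := by
      ext l
      · simp [v, Prod.fst_sum, Finset.sum_apply, Pi.single_apply]
      · simp [v, Prod.snd_sum]
    have h2 := hv s
    rw [h1, map_add, map_sum] at h2
    simp only [map_smul] at h2
    exact eq_neg_of_add_eq_zero_left h2
  have hscal (a : A) (b : B) : φ a * b = a • b := (Algebra.smul_def a b).symm
  have key : (1 : B) ⊗ₜ[A] q (0, 1) = (1 : B) ⊗ₜ[A] (0 : ((κ → A) × A) ⧸ N) := by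
    rw [TensorProduct.tmul_zero, ← hu, TensorProduct.sum_tmul]
    have h1 (s : ι) : (φ (u s) * e s) ⊗ₜ[A] q (0, 1) =
        - ∑ l, (φ (c s l) * e s) ⊗ₜ[A] q (Pi.single l 1, 0) := by
      have : ((0, u s) : (κ → A) × A) = u s • (0, 1) := by simp
      rw [hscal, TensorProduct.smul_tmul, ← map_smul, ← this, hsplit, TensorProduct.tmul_neg,
        TensorProduct.tmul_sum]
      simp only [hscal, TensorProduct.smul_tmul]
    simp only [h1]
    rw [Finset.sum_neg_distrib, Finset.sum_comm]
    simp only [← TensorProduct.sum_tmul, hc, TensorProduct.zero_tmul, Finset.sum_const_zero,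
      neg_zero]
  have h0 : q (0, 1) = 0 := h _ key
  rw [Submodule.mkQ_apply, Submodule.Quotient.mk_eq_zero, Submodule.mem_span_range_iff_exists_fun]
    at h0
  obtain ⟨a, ha⟩ := h0
  refine ⟨a, fun l => ?_, ?_⟩
  · have := congrFun (congrArg Prod.fst ha) l
    simpa [v, Prod.fst_sum, Finset.sum_apply] using this
  · have := congrArg Prod.snd ha
    simpa [v, Prod.snd_sum] using this

end Purity

/-! ### Localization of `p⁻¹`-linear maps -/

section Localization

variable {A : Type u} [CommRing A] {p : ℕ} (ψ : A →+ A)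

/-- A `p⁻¹`-linear map extends to any localization. -/
lemma exists_localization_pow_linear (hp : p ≠ 0) (hψ : ∀ a b, ψ (a ^ p * b) = a * ψ b)
    (S : Submonoid A) :
    ∃ Ψ : Localization S →+ Localization S, (∀ a b, Ψ (a ^ p * b) = a * Ψ b) ∧
      Ψ 1 = algebraMap A _ (ψ 1) := by
  have hψ' (s b : A) : s * ψ b = ψ (s * (s ^ (p - 1) * b)) := by
    rw [← mul_assoc, mul_pow_sub_one hp, hψ]
  -- Since `b / s = s ^ (p - 1) b / s ^ p`, linearity forces this value on fractions.
  let F : A → S → Localization S := fun b s => Localization.mk (ψ ((s : A) ^ (p - 1) * b)) s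
  have hF {b b' : A} {s s' : S} (h : Localization.r S (b, s) (b', s')) : F b s = F b' s' := by
    rw [Localization.r_iff_exists] at h
    obtain ⟨c, hc⟩ := h
    simp only at hc
    rw [Localization.mk_eq_mk_iff, Localization.r_iff_exists]
    refine ⟨c, ?_⟩
    simp only [hψ']
    congr 1
    calc _ = (c : A) ^ (p - 1) * s' ^ (p - 1) * s ^ (p - 1) * (c * (s' * b)) := by ring
      _ = _ := by rw [hc]; ring
  let Ψ₀ : Localization S → Localization S := fun x => Localization.liftOn x F hF
  have hΨ₀ (b : A) (s : S) : Ψ₀ (Localization.mk b s) =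
    Localization.mk (ψ ((s : A) ^ (p - 1) * b)) s := Localization.liftOn_mk _ _ _ _
  refine ⟨AddMonoidHom.mk' Ψ₀ fun x y => ?_, fun x y => ?_, ?_⟩
  · induction x using Localization.induction_on with | H x => ?_
    induction y using Localization.induction_on with | H y => ?_
    obtain ⟨b, s⟩ := x
    obtain ⟨b', s'⟩ := y
    simp only [Localization.add_mk, hΨ₀, Submonoid.coe_mul]
    congr 1
    rw [hψ', hψ', ← map_add]
    congr 1
    ring
  · induction x using Localization.induction_on with | H x => ?_
    induction y using Localization.induction_on with | H y => ?_
    obtain ⟨a, t⟩ := x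
    obtain ⟨b, s⟩ := y
    simp only [AddMonoidHom.mk'_apply, Localization.mk_pow, Localization.mk_mul, hΨ₀]
    rw [Localization.mk_eq_mk_iff, Localization.r_iff_exists]
    refine ⟨1, ?_⟩
    simp only [Submonoid.coe_mul, OneMemClass.coe_one, one_mul, SubmonoidClass.coe_pow]
    have : ((t : A) ^ p * s) ^ (p - 1) * (a ^ p * b) =
        ((t : A) ^ (p - 1) * a) ^ p * ((s : A) ^ (p - 1) * b) := by ring
    rw [this, hψ, ← mul_pow_sub_one hp (t : A)]
    ring
  · rw [AddMonoidHom.mk'_apply, ← Localization.mk_one, hΨ₀, ← Localization.mk_one_eq_algebraMap]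
    simp

lemma IsFPure.localization [Fact p.Prime] (hA : (p : A) = 0)
    (hψ : ∀ a b, ψ (a ^ p * b) = a * ψ b) (S : Submonoid A) (h1 : ψ 1 ∈ S) :
    IsFPure p (Localization S) := by
  obtain ⟨Ψ, hΨ, hΨ1⟩ := exists_localization_pow_linear ψ (Fact.out : p.Prime).ne_zero hψ S
  have hu : IsUnit (algebraMap A (Localization S) (ψ 1)) := IsLocalization.map_units _ ⟨_, h1⟩
  obtain ⟨v, hv⟩ := hu.exists_left_inv
  refine ⟨by rw [← map_natCast (algebraMap A (Localization S)), hA, map_zero],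
    IsPure.of_retraction _ ((AddMonoidHom.mulLeft v).comp Ψ) (fun a b => ?_) ?_⟩
  · change v * Ψ (a ^ p * b) = a * (v * Ψ b)
    rw [hΨ]; ring
  · change v * Ψ 1 = 1
    rw [hΨ1, hv]

end Localization

/-! ### Fedder's criterion -/

section Fedder

variable {k : Type u} [Field k] {n p : ℕ} [hp : Fact p.Prime] [CharP k p] {ι : Type} [Fintype ι]
  (B : FrobCoord p (Poly k n) ι)

omit hp [CharP k p] in
lemma mk_mem_map_primeCompl (f : Poly k n) (P : Ideal (Poly k n)) [P.IsPrime] {x : Poly k n}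
    (hx : x ∉ P) : Ideal.Quotient.mk (Ideal.span {f}) x ∈
      P.primeCompl.map (Ideal.Quotient.mk (Ideal.span {f})) := ⟨x, hx, rfl⟩

/-- A `p⁻¹`-linear map of `R` preserving `fR` with value outside `P` at `1` shows that `(R/fR)_P` is
`F`-pure. -/
lemma isFPure_hypLoc_of_map (f : Poly k n) (P : Ideal (Poly k n)) [P.IsPrime]
    (ψ : Poly k n →+ Poly k n) (hψ : ∀ a b, ψ (a ^ p * b) = a * ψ b)
    (hf : ∀ b, f ∣ ψ (f * b)) (h1 : ψ 1 ∉ P) : IsFPure p (HypLoc f P) := by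
  let I : Ideal (Poly k n) := Ideal.span {f}
  let ψ' : Hyp f →+ Hyp f := QuotientAddGroup.map I.toAddSubgroup I.toAddSubgroup ψ (by
    intro x hx
    obtain ⟨b, rfl⟩ := Ideal.mem_span_singleton.mp hx
    exact Ideal.mem_span_singleton.mpr (hf b))
  have hψ' (x : Poly k n) : ψ' (Ideal.Quotient.mk I x) = Ideal.Quotient.mk I (ψ x) := rfl
  refine IsFPure.localization ψ' (natCast_hyp p f) (fun a b => ?_) _ ?_
  · obtain ⟨a, rfl⟩ := Ideal.Quotient.mk_surjective a
    obtain ⟨b, rfl⟩ := Ideal.Quotient.mk_surjective b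
    rw [← map_pow, ← map_mul, hψ', hψ, map_mul, ← hψ']
  · rw [← map_one (Ideal.Quotient.mk I), hψ']
    exact mk_mem_map_primeCompl f P h1

include B

/-- If `τ ⊄ P`, some coordinate `φ` has `φ(f^{p-1}) ∉ P`. The map `b ↦ φ(f^{p-1} b)` preserves `fR`,
because `φ(f^p b) = f φ(b)`. -/
lemma FrobCoord.isFPure_hypLoc (f : Poly k n) (P : Ideal (Poly k n)) [P.IsPrime]
    (h : ¬ testIdeal p f 1 ≤ P) : IsFPure p (HypLoc f P) := by
  have : ∃ i, B.coord i (f ^ (p - 1)) ∉ P := by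
    by_contra! h'
    refine h ?_
    rw [B.testIdeal_eq, Ideal.span_le]
    rintro _ ⟨i, rfl⟩
    exact h' i
  obtain ⟨i, hi⟩ := this
  refine isFPure_hypLoc_of_map f P ((B.coord i).comp (AddMonoidHom.mulLeft (f ^ (p - 1))))
    (fun a b => ?_) (fun b => ?_) (by simpa using hi)
  · simp only [AddMonoidHom.comp_apply, AddMonoidHom.coe_mulLeft]
    rw [mul_left_comm, B.coord_pow_mul]
  · simp only [AddMonoidHom.comp_apply, AddMonoidHom.coe_mulLeft]
    rw [← mul_assoc, pow_sub_one_mul hp.out.ne_zero, B.coord_pow_mul]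
    exact dvd_mul_right _ _

/-- The case `f = 0` must be separated: there `τ = 0` lies in every prime, although `R` is F-pure.
-/
lemma FrobCoord.isFPure_hypLoc_zero (P : Ideal (Poly k n)) [P.IsPrime] :
    IsFPure p (HypLoc (0 : Poly k n) P) := by
  obtain ⟨i, hi⟩ := B.exists_coord_one_notMem P
  exact isFPure_hypLoc_of_map 0 P (B.coord i) (B.coord_pow_mul i) (by simp) hi

omit hp [CharP k p] [Fintype ι] B in
lemma exists_denominators [Finite ι] (f : Poly k n) (P : Ideal (Poly k n)) [P.IsPrime]
    (a : ι → HypLoc f P) : ∃ t ∉ P, ∃ α : ι → Poly k n, ∀ i,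
      algebraMap (Hyp f) (HypLoc f P) (Ideal.Quotient.mk _ t) * a i =
        algebraMap (Hyp f) (HypLoc f P) (Ideal.Quotient.mk _ (α i)) := by
  obtain ⟨⟨_, t, ht, rfl⟩, h⟩ := IsLocalization.exist_integer_multiples_of_finite
    (P.primeCompl.map (Ideal.Quotient.mk (Ideal.span {f}))) a
  choose β hβ using h
  choose α hα using fun i => Ideal.Quotient.mk_surjective (β i)
  refine ⟨t, ht, α, fun i => ?_⟩
  rw [hα, hβ, Algebra.smul_def]

omit hp [CharP k p] [Fintype ι] B in
lemma exists_mul_dvd_of_algebraMap_eq_zero (f : Poly k n) (P : Ideal (Poly k n)) [P.IsPrime]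
    (x : Poly k n) (h : algebraMap (Hyp f) (HypLoc f P) (Ideal.Quotient.mk _ x) = 0) :
    ∃ t ∉ P, f ∣ t * x := by
  rw [IsLocalization.map_eq_zero_iff (P.primeCompl.map (Ideal.Quotient.mk (Ideal.span {f})))] at h
  obtain ⟨⟨_, t, ht, rfl⟩, h⟩ := h
  refine ⟨t, ht, ?_⟩
  rw [← map_mul, Ideal.Quotient.eq_zero_iff_mem, Ideal.mem_span_singleton] at h
  exact h

omit [CharP k p] in
/-- Fedder's criterion. -/
lemma FrobCoord.not_isFPure_hypLoc {f : Poly k n} (hf : f ≠ 0) (P : Ideal (Poly k n)) [P.IsPrime]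
    (h : testIdeal p f 1 ≤ P) : ¬ IsFPure p (HypLoc f P) := by
  rintro ⟨hA, hpure⟩
  let η : Poly k n →+* HypLoc f P :=
    (algebraMap (Hyp f) (HypLoc f P)).comp (Ideal.Quotient.mk _)
  have hηf : η f = 0 := by
    change algebraMap (Hyp f) (HypLoc f P) (Ideal.Quotient.mk _ f) = 0
    rw [Ideal.Quotient.eq_zero_iff_mem.mpr (Ideal.mem_span_singleton_self f), map_zero]
  -- The system consists of the expansions of `f e_l = 0` and of `1` in coordinates. A solution `a`
  -- gives the `p⁻¹`-linear map `b ↦ ∑ a_s coord_s b`, which kills all `f e_l` and sends `1` to `1`.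
  obtain ⟨a, ha, ha1⟩ := hpure.exists_solution (fun s l => η (B.coord s (f * B.e l)))
    (fun s => η (B.coord s 1)) (fun s => η (B.e s))
    (fun l => by
      change ∑ s, η (B.coord s (f * B.e l)) ^ p * η (B.e s) = 0
      simp only [← map_pow, ← map_mul, ← map_sum]
      rw [B.sum_eq, map_mul, hηf, zero_mul])
    (by
      change ∑ s, η (B.coord s 1) ^ p * η (B.e s) = 1
      simp only [← map_pow, ← map_mul, ← map_sum]
      rw [B.sum_eq, map_one])
  obtain ⟨t, ht, α, hα⟩ := exists_denominators f P a
  change ∀ i, η t * a i = η (α i) at hα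
  have h1 (l : ι) : η (∑ s, α s * B.coord s (f * B.e l)) = 0 := by
    simp only [map_sum, map_mul, ← hα, mul_assoc]
    rw [← Finset.mul_sum, ha, mul_zero]
  have h2 : η (∑ s, α s * B.coord s 1 - t) = 0 := by
    simp only [map_sub, map_sum, map_mul, ← hα, mul_assoc]
    rw [← Finset.mul_sum, ha1, mul_one, sub_self]
  choose r hrP hr using fun l => exists_mul_dvd_of_algebraMap_eq_zero f P _ (h1 l)
  obtain ⟨r', hrP', hr'⟩ := exists_mul_dvd_of_algebraMap_eq_zero f P _ h2
  -- One multiplier outside `P` turns all these identities in `(R/fR)_P` into divisibilities by `f`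
  -- in `R`.
  let T := r' * ∏ l, r l
  have hT : T ∉ P := by
    intro hT
    rcases Ideal.IsPrime.mem_or_mem inferInstance hT with h | h
    · exact hrP' h
    · obtain ⟨l, -, hl⟩ := (Ideal.IsPrime.prod_mem_iff (p := P)).mp h
      exact hrP l hl
  have h3 (l : ι) : f ∣ T * ∑ s, α s * B.coord s (f * B.e l) :=
    (hr l).trans (mul_dvd_mul_right ((Finset.dvd_prod_of_mem r (Finset.mem_univ l)).mul_left _) _)
  choose β hβ using h3
  let ψ : Poly k n → Poly k n := fun b => T * ∑ s, α s * B.coord s b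
  have hψ (b : Poly k n) : ψ (f * b) = f * ∑ l, B.coord l b * β l := by
    have : f * b = ∑ l, B.coord l b ^ p * (f * B.e l) := by
      conv_lhs => rw [← B.sum_eq b, Finset.mul_sum]
      exact Finset.sum_congr rfl fun l _ => by ring
    rw [this]
    simp only [ψ, map_sum, B.coord_pow_mul]
    simp only [Finset.mul_sum]
    rw [Finset.sum_comm]
    refine Finset.sum_congr rfl fun l _ => ?_
    rw [mul_left_comm, ← hβ, Finset.mul_sum, Finset.mul_sum]
    exact Finset.sum_congr rfl fun s _ => by ring
  -- Evaluating `ψ` at `f ^ p = f * f ^ (p - 1)` in two ways and cancelling `f` expresses `ψ 1`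
  -- through the coordinates of `f ^ (p - 1)`, which lie in `τ ≤ P`.
  have h4 : f * ψ 1 = f * ∑ l, B.coord l (f ^ (p - 1)) * β l := by
    rw [← hψ, mul_pow_sub_one hp.out.ne_zero]
    simp only [ψ, Finset.mul_sum]
    refine Finset.sum_congr rfl fun s _ => ?_
    conv_rhs => rw [← mul_one (f ^ p), B.coord_pow_mul]
    ring
  have h5 : ψ 1 ∈ P := by
    rw [mul_left_cancel₀ hf h4]
    exact Ideal.sum_mem _ fun l _ => Ideal.mul_mem_right _ _ (h (B.coord_mem_testIdeal f l))
  -- This element is `ψ 1 - T t`, with `ψ 1 ∈ P`; hence `T t ∈ P`, although neither factor is in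
  -- `P`.
  have h6 : T * (∑ s, α s * B.coord s 1 - t) ∈ P := by
    have : f ∣ T * (∑ s, α s * B.coord s 1 - t) :=
      hr'.trans (mul_dvd_mul_right (dvd_mul_right _ _) _)
    exact Ideal.mem_of_dvd P this (h (B.self_mem_testIdeal f))
  rw [mul_sub] at h6
  rcases Ideal.IsPrime.mem_or_mem inferInstance ((Submodule.sub_mem_iff_right P h5).mp h6) with h | h
  · exact hT h
  · exact ht h

lemma FrobCoord.isFPure_hypLoc_iff {f : Poly k n} (hf : f ≠ 0) (P : Ideal (Poly k n)) [P.IsPrime] :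
    IsFPure p (HypLoc f P) ↔ ¬ testIdeal p f 1 ≤ P :=
  ⟨fun h h' => B.not_isFPure_hypLoc hf P h' h, B.isFPure_hypLoc f P⟩

end Fedder

/-! ### Frobenius powers of `𝔪`, homogeneity, and the numbers `M_e` -/

section

open MvPolynomial

lemma frobPower_span {R : Type*} [CommRing R] (p : ℕ) [hp : Fact p.Prime] [CharP R p] (S : Set R)
    (e : ℕ) : frobPower p (Ideal.span S) e = Ideal.span ((fun u => u ^ p ^ e) '' S) := by
  apply le_antisymm
  · rw [frobPower, Ideal.span_le]
    rintro _ ⟨u, hu, rfl⟩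
    simp only [SetLike.mem_coe]
    refine Submodule.span_induction (p := fun u _ => u ^ p ^ e ∈
      Ideal.span ((fun u => u ^ p ^ e) '' S)) ?_ ?_ ?_ ?_ hu
    · exact fun x hx => Ideal.subset_span ⟨x, hx, rfl⟩
    · rw [zero_pow (pow_ne_zero _ hp.out.ne_zero)]; exact Ideal.zero_mem _
    · intro x y _ _ hx hy
      rw [add_pow_char_pow]; exact Ideal.add_mem _ hx hy
    · intro a x _ hx
      rw [smul_eq_mul, mul_pow]; exact Ideal.mul_mem_left _ _ hx
  · exact Ideal.span_mono (Set.image_mono Ideal.subset_span)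

lemma frobPower_frobPower {R : Type*} [CommRing R] (p : ℕ) [hp : Fact p.Prime] [CharP R p]
    (I : Ideal R) (e e' : ℕ) : frobPower p (frobPower p I e) e' = frobPower p I (e + e') := by
  change frobPower p (Ideal.span _) e' = _
  rw [frobPower_span, Set.image_image]
  simp only [← pow_mul, ← pow_add]
  rfl

variable {k : Type u} [Field k] {n p : ℕ} [hp : Fact p.Prime] [CharP k p]

/-- The ideal is generated by the monomials `x_i ^ (p ^ e)`, so membership is tested on each
exponent separately. -/
lemma mem_frobPower_maxIdeal {e : ℕ} {g : Poly k n} :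
    g ∈ frobPower p (maxIdeal k n) e ↔ ∀ a, coeff a g ≠ 0 → ∃ i, p ^ e ≤ a i := by
  have : frobPower p (maxIdeal k n) e = Ideal.span ((fun s => monomial s (1 : k)) ''
      Set.range fun i => Finsupp.single i (p ^ e)) := by
    rw [maxIdeal, frobPower_span, ← Set.range_comp, ← Set.range_comp]
    congr 2
    funext i
    simp [X_pow_eq_monomial]
  rw [this, mem_ideal_span_monomial_image]
  simp

lemma mem_maxIdeal_iff {g : Poly k n} : g ∈ maxIdeal k n ↔ coeff 0 g = 0 := by
  have := mem_pow_idealOfVars_iff' 1 g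
  rw [pow_one] at this
  change g ∈ idealOfVars _ _ ↔ _
  rw [this]
  simp [Finsupp.degree_eq_zero_iff]

section Homogeneous

lemma homogeneousComponent_mul_of_isHomogeneous {σ R : Type*} [CommSemiring R]
    (g : MvPolynomial σ R) {c : MvPolynomial σ R} {D : ℕ}
    (hc : c.IsHomogeneous D) (s : ℕ) :
    homogeneousComponent (s + D) (g * c) = homogeneousComponent s g * c := by
  conv_lhs => rw [← sum_homogeneousComponent g, Finset.sum_mul, map_sum]
  have h (i : ℕ) : homogeneousComponent (s + D) (homogeneousComponent i g * c) =
      if i = s then homogeneousComponent s g * c else 0 := by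
    rw [homogeneousComponent_of_mem ((homogeneousComponent_isHomogeneous i g).mul hc)]
    by_cases h : i = s
    · simp [h]
    · rw [if_neg h, if_neg (by omega)]
  simp only [h]
  rw [Finset.sum_ite_eq']
  split_ifs with hs
  · rfl
  · rw [homogeneousComponent_eq_zero s g (by simpa using hs), zero_mul]

variable {ι : Type} [Fintype ι] (B : FrobCoord p (Poly k n) ι)
  (hB : ∀ i (g : Poly k n) (D : ℕ), g.IsHomogeneous D → ∃ D', (B.coord i g).IsHomogeneous D')
  {f : Poly k n} {d : ℕ} (hf : f.IsHomogeneous d)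
include hB hf

omit hp [CharP k p] in
attribute [local instance] MvPolynomial.gradedAlgebra in
/-- A homogeneous test ideal which defines the origin set-theoretically contains a power of `𝔪`. -/
lemma FrobCoord.exists_maxIdeal_pow_le
    (hP : ∀ (P : Ideal (Poly k n)) [P.IsPrime], P < maxIdeal k n → ¬ testIdeal p f 1 ≤ P) :
    ∃ N : ℕ, maxIdeal k n ^ N ≤ testIdeal p f 1 := by
  refine Ideal.exists_pow_le_of_le_radical_of_fg ?_ (IsNoetherian.noetherian _)
  rw [Ideal.radical_eq_sInf]
  refine le_sInf ?_
  rintro P ⟨hτP, hPp⟩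
  let 𝒜 := homogeneousSubmodule (Fin (n + 1)) k
  -- The homogeneous core of a prime over `τ` is again prime, contains the homogeneously generated
  -- `τ`, and lies in `𝔪`. By hypothesis it equals `𝔪`, so `𝔪 ≤ P`.
  let Q := P.homogeneousCore 𝒜
  have hQp : Q.toIdeal.IsPrime := hPp.homogeneousCore
  have hQ : testIdeal p f 1 ≤ Q.toIdeal := by
    rw [B.testIdeal_eq, Ideal.span_le]
    rintro _ ⟨i, rfl⟩
    obtain ⟨D, hD⟩ := hB i _ _ (hf.pow (p - 1))
    exact Ideal.mem_homogeneousCore_of_homogeneous_of_mem ⟨D, hD⟩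
      (hτP (B.coord_mem_testIdeal f i))
  have hQm : Q.toIdeal ≤ maxIdeal k n := by
    intro g hg
    rw [mem_maxIdeal_iff]
    by_contra h0
    have h1 := homogeneousComponent_mem_of_mem Q.isHomogeneous hg 0
    rw [homogeneousComponent_zero] at h1
    exact hQp.ne_top (Ideal.eq_top_of_isUnit_mem _ h1 ((isUnit_iff_ne_zero.mpr h0).map C))
  rcases hQm.lt_or_eq with h | h
  · exact absurd hQ (hP _ h)
  · rw [← h]
    exact Ideal.toIdeal_homogeneousCore_le 𝒜 P

/-- The ideal `τ` has homogeneous generators `c`, and each `g_s c` is a homogeneous component of `g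
c`. A monomial ideal contains the components of its elements. -/
lemma FrobCoord.homogeneousComponent_mem_colon {e : ℕ} {g : Poly k n}
    (hg : g ∈ (frobPower p (maxIdeal k n) e).colon (testIdeal p f 1 : Set (Poly k n))) (s : ℕ) :
    homogeneousComponent s g ∈
      (frobPower p (maxIdeal k n) e).colon (testIdeal p f 1 : Set (Poly k n)) := by
  rw [← B.pow_mul_pow_mem_iff, B.mem_frobPower_iff] at hg ⊢
  intro i
  specialize hg i
  rw [B.coord_mul_pow] at hg ⊢
  obtain ⟨D, hD⟩ := hB i _ _ (hf.pow (p - 1))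
  rw [← homogeneousComponent_mul_of_isHomogeneous g hD, mem_frobPower_maxIdeal]
  intro a ha
  rw [coeff_homogeneousComponent] at ha
  refine mem_frobPower_maxIdeal.mp hg a fun h => ha ?_
  rw [h, ite_self]

end Homogeneous

section MinShift

/-- The degrees of homogeneous elements of `(𝔪^{[p^e]} : τ) \ 𝔪^{[p^e]}`. -/
def colonDegrees (p : ℕ) (f : Poly k n) (e : ℕ) : Set ℕ :=
  {s | ∃ g : Poly k n, g.IsHomogeneous s ∧
    g ∈ (frobPower p (maxIdeal k n) e).colon (testIdeal p f 1 : Set (Poly k n)) ∧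
    g ∉ frobPower p (maxIdeal k n) e}

/-- `δ` is the minimum of the `s - (n + 1) p ^ e` for `s` in `colonDegrees p f e`, attained for all
large `e`. -/
def IsMinShift (p : ℕ) (f : Poly k n) (δ : ℤ) : Prop :=
  (∀ e, ∀ s ∈ colonDegrees p f e, δ ≤ (s : ℤ) - (n + 1) * p ^ e) ∧
    ∀ᶠ e in Filter.atTop, ∃ s ∈ colonDegrees p f e, (s : ℤ) - (n + 1) * p ^ e = δ

variable {f : Poly k n}

omit hp [CharP k p] in
lemma IsMinShift.isDelta {δ : ℤ} (h : IsMinShift p f δ) : IsDelta p f δ := by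
  filter_upwards [h.2] with e he
  obtain ⟨s, hs, hδ⟩ := he
  refine ⟨s, le_antisymm (sInf_le ?_) (le_sInf ?_), hδ⟩
  · obtain ⟨g, h1, h2, h3⟩ := hs
    exact ⟨s, g, h1, h2, h3, rfl⟩
  · rintro _ ⟨t, g, h1, h2, h3, rfl⟩
    have := h.1 e t ⟨g, h1, h2, h3⟩
    have : s ≤ t := by omega
    exact_mod_cast this

/-- Multiplication by `(x₀ ⋯ xₙ)^t` is the injective transition map `R/𝔪^{[p^e]} → R/𝔪^{[p^e']}` of
the direct system with limit `H^{n+1}_𝔪(R)`. -/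
lemma mul_monomial_mem_frobPower_iff {e e' t : ℕ} (h : p ^ e' = p ^ e + t) (g : Poly k n) :
    g * monomial (Finsupp.equivFunOnFinite.symm fun _ => t) 1 ∈ frobPower p (maxIdeal k n) e' ↔
      g ∈ frobPower p (maxIdeal k n) e := by
  rw [mem_frobPower_maxIdeal, mem_frobPower_maxIdeal]
  constructor
  · intro H a ha
    obtain ⟨i, hi⟩ := H (a + Finsupp.equivFunOnFinite.symm fun _ => t) (by
      rwa [coeff_mul_monomial, mul_one])
    refine ⟨i, ?_⟩
    simp only [Finsupp.coe_add, Pi.add_apply, Finsupp.equivFunOnFinite_symm_apply_apply] at hi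
    omega
  · intro H a ha
    rw [coeff_mul_monomial'] at ha
    split_ifs at ha with hle
    · obtain ⟨i, hi⟩ := H _ (by simpa using ha)
      refine ⟨i, ?_⟩
      have := hle i
      simp only [Finsupp.coe_tsub, Pi.sub_apply, Finsupp.equivFunOnFinite_symm_apply_apply] at hi this
      omega
    · exact absurd rfl ha

lemma degree_equivFunOnFinite_symm (a : Fin (n + 1) → ℕ) :
    (Finsupp.equivFunOnFinite.symm a).degree = ∑ i, a i := by
  rw [Finsupp.degree_eq_sum]; rfl

lemma colonDegrees_succ {e s : ℕ} (hs : s ∈ colonDegrees p f e) :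
    s + (n + 1) * (p ^ (e + 1) - p ^ e) ∈ colonDegrees p f (e + 1) := by
  obtain ⟨g, h1, h2, h3⟩ := hs
  have hle : p ^ e ≤ p ^ (e + 1) := Nat.pow_le_pow_right hp.out.pos e.le_succ
  have hpe : p ^ (e + 1) = p ^ e + (p ^ (e + 1) - p ^ e) := by omega
  refine ⟨g * monomial (Finsupp.equivFunOnFinite.symm fun _ => p ^ (e + 1) - p ^ e) 1, ?_, ?_, ?_⟩
  · refine h1.mul (isHomogeneous_monomial _ ?_)
    rw [degree_equivFunOnFinite_symm]; simp
  · rw [Submodule.mem_colon] at h2 ⊢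
    intro c hc
    rw [smul_eq_mul, mul_right_comm, mul_monomial_mem_frobPower_iff hpe]
    exact h2 c hc
  · rwa [mul_monomial_mem_frobPower_iff hpe]

/-- Choose a monomial `x^a` of `g` with all exponents below `q = p^e`, and complete it by `x^b` to
exponents `q - 1`. Then `g x^b ∉ 𝔪^{[q]}`, so `x^b ∉ τ` and `deg b < N`. -/
lemma neg_sub_le_of_mem_colonDegrees {N : ℕ} (hN : maxIdeal k n ^ N ≤ testIdeal p f 1) (e s : ℕ)
    (hs : s ∈ colonDegrees p f e) : -(n : ℤ) - N ≤ (s : ℤ) - (n + 1) * p ^ e := by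
  obtain ⟨g, h1, h2, h3⟩ := hs
  rw [mem_frobPower_maxIdeal] at h3
  push Not at h3
  obtain ⟨a, ha, hq⟩ := h3
  let b : Fin (n + 1) →₀ ℕ := Finsupp.equivFunOnFinite.symm fun i => p ^ e - 1 - a i
  have hab : a.degree + b.degree = (n + 1) * (p ^ e - 1) := by
    rw [← map_add, Finsupp.degree_eq_sum]
    have (i : Fin (n + 1)) : (a + b) i = p ^ e - 1 := by
      have := hq i
      simp only [b, Finsupp.coe_add, Pi.add_apply, Finsupp.equivFunOnFinite_symm_apply_apply]
      omega
    simp [this]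
  have hs : a.degree = s := isHomogeneous_iff_degree.mp h1 a ha
  have hb : b.degree < N := by
    by_contra! hb
    have h4 : monomial b (1 : k) ∈ testIdeal p f 1 :=
      hN ((monomial_mem_pow_idealOfVars_iff N b one_ne_zero).mpr hb)
    have h5 := Submodule.mem_colon.mp h2 _ h4
    rw [smul_eq_mul, mem_frobPower_maxIdeal] at h5
    obtain ⟨i, hi⟩ := h5 (a + b) (by rwa [coeff_mul_monomial, mul_one])
    have := hq i
    simp only [b, Finsupp.coe_add, Pi.add_apply, Finsupp.equivFunOnFinite_symm_apply_apply] at hi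
    omega
  have hpos : 1 ≤ p ^ e := Nat.one_le_pow _ _ hp.out.pos
  zify [hpos] at hab hs hb
  linarith

omit hp [CharP k p] in
-- At `e = 0` the Frobenius power is `𝔪` itself, and `g = 1` is a witness; it makes the set of
-- differences nonempty.
lemma zero_mem_colonDegrees (h : testIdeal p f 1 ≤ maxIdeal k n) : 0 ∈ colonDegrees p f 0 := by
  have h0 : frobPower p (maxIdeal k n) 0 = maxIdeal k n := by
    simp [frobPower]
  refine ⟨1, isHomogeneous_one _ _, ?_, ?_⟩
  · rw [h0, Submodule.mem_colon]
    intro c hc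
    rw [smul_eq_mul, one_mul]; exact h hc
  · rw [h0]
    exact fun h => maxIdeal_isPrime.ne_top ((Ideal.eq_top_iff_one _).mpr h)

lemma eventually_colonDegrees {e s : ℕ} (hs : s ∈ colonDegrees p f e) :
    ∀ᶠ e' in Filter.atTop, ∃ s' ∈ colonDegrees p f e',
      (s' : ℤ) - (n + 1) * p ^ e' = s - (n + 1) * p ^ e := by
  rw [Filter.eventually_atTop]
  refine ⟨e, fun e' he' => ?_⟩
  induction e', he' using Nat.le_induction with
  | base => exact ⟨s, hs, rfl⟩
  | succ e' _ ih =>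
    obtain ⟨s', hs', h⟩ := ih
    refine ⟨_, colonDegrees_succ hs', ?_⟩
    have hle : p ^ e' ≤ p ^ (e' + 1) := Nat.pow_le_pow_right hp.out.pos e'.le_succ
    rw [← h]
    push_cast [hle]
    ring

lemma exists_isMinShift {N : ℕ} (hN : maxIdeal k n ^ N ≤ testIdeal p f 1)
    (hτ : testIdeal p f 1 ≤ maxIdeal k n) : ∃ δ, IsMinShift p f δ := by
  obtain ⟨δ, ⟨e, s, hs, rfl⟩, hmin⟩ := Int.exists_least_of_bdd
    (P := fun z => ∃ e, ∃ s ∈ colonDegrees p f e, (s : ℤ) - (n + 1) * p ^ e = z)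
    ⟨-(n : ℤ) - N, by
      rintro _ ⟨e, s, hs, rfl⟩
      exact neg_sub_le_of_mem_colonDegrees hN e s hs⟩
    ⟨_, 0, 0, zero_mem_colonDegrees hτ, rfl⟩
  exact ⟨_, fun e s hs => hmin _ ⟨e, s, hs, rfl⟩, eventually_colonDegrees hs⟩

lemma isMinShift_of_testIdeal_eq {j : ℕ} (hj : 1 ≤ j) (h : testIdeal p f 1 = maxIdeal k n ^ j) :
    IsMinShift p f (-n - j) := by
  refine ⟨neg_sub_le_of_mem_colonDegrees h.ge, ?_⟩
  obtain ⟨e, he⟩ : ∃ e, j ≤ p ^ e := ⟨j, (Nat.lt_pow_self hp.out.one_lt).le⟩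
  -- With `q = p^e`, this exponent has degree `(n+1)(q-1) - (j-1)`, while monomials outside
  -- `𝔪^{[q]}` have degree at most `(n+1)(q-1)`. Multiplying by anything of degree at least `j`
  -- therefore lands in `𝔪^{[q]}`.
  let a : Fin (n + 1) → ℕ := fun i => if i = 0 then p ^ e - j else p ^ e - 1
  have ha (i : Fin (n + 1)) : a i < p ^ e := by
    simp only [a]; split_ifs <;> omega
  have hsum : ∑ i, a i = p ^ e - j + n * (p ^ e - 1) := by
    rw [Fin.sum_univ_succ]
    simp [a, Fin.succ_ne_zero]
  have hs : ∑ i, a i ∈ colonDegrees p f e := by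
    refine ⟨monomial (Finsupp.equivFunOnFinite.symm a) 1, isHomogeneous_monomial _
      (degree_equivFunOnFinite_symm a), ?_, ?_⟩
    · rw [Submodule.mem_colon, h]
      intro c hc
      rw [smul_eq_mul, mem_frobPower_maxIdeal]
      intro b hb
      rw [coeff_monomial_mul'] at hb
      split_ifs at hb with hle
      swap
      · exact absurd rfl hb
      rw [one_mul] at hb
      have hdeg := (mem_pow_idealOfVars_iff j c).mp hc _ (mem_support_iff.mpr hb)
      by_contra! hlt
      have h1 : (Finsupp.equivFunOnFinite.symm a).degree +
          (b - Finsupp.equivFunOnFinite.symm a).degree = b.degree := by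
        rw [← map_add, add_tsub_cancel_of_le hle]
      have h2 : b.degree ≤ (n + 1) * (p ^ e - 1) := by
        rw [Finsupp.degree_eq_sum]
        refine (Finset.sum_le_sum (g := fun _ => p ^ e - 1) fun i _ => ?_).trans (by simp)
        have := hlt i
        omega
      rw [degree_equivFunOnFinite_symm, hsum] at h1
      rw [add_mul, one_mul] at h2
      omega
    · rw [mem_frobPower_maxIdeal]
      push Not
      exact ⟨Finsupp.equivFunOnFinite.symm a, by simp, ha⟩
  have hval : ((∑ i, a i : ℕ) : ℤ) - (n + 1) * p ^ e = -n - j := by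
    rw [hsum]
    have : 1 ≤ p ^ e := Nat.one_le_pow _ _ hp.out.pos
    push_cast [he, this]
    ring
  rw [← hval]
  exact eventually_colonDegrees hs

end MinShift

end

/-! ### Alternating sums over finite subsets -/

section Alternating

variable {m : ℕ}

/-- The sign `(-1)` to the power of the position of `j` in `J`. -/
def posSign (j : Fin m) (J : Finset (Fin m)) : ℤ := (-1) ^ (J.filter (· < j)).card

lemma posSign_mul_self (j : Fin m) (J : Finset (Fin m)) : posSign j J * posSign j J = 1 := by
  rw [posSign, ← mul_pow]; simp

lemma posSign_insert_of_lt {i j : Fin m} {J : Finset (Fin m)} (hi : i ∉ J) (h : i < j) :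
    posSign j (insert i J) = - posSign j J := by
  rw [posSign, Finset.filter_insert, if_pos h, Finset.card_insert_of_notMem (by simp [hi]),
    pow_succ, posSign]
  ring

lemma posSign_insert_of_le {i j : Fin m} {J : Finset (Fin m)} (h : j ≤ i) :
    posSign j (insert i J) = posSign j J := by
  rw [posSign, Finset.filter_insert, if_neg h.not_gt, posSign]

lemma posSign_insert_mul {i j : Fin m} {J : Finset (Fin m)} (hij : i ≠ j) (hi : i ∉ J)
    (hj : j ∉ J) :
    posSign j (insert i J) * posSign i J = - (posSign i (insert j J) * posSign j J) := by
  rcases hij.lt_or_gt with h | h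
  · rw [posSign_insert_of_lt hi h, posSign_insert_of_le h.le]; ring
  · rw [posSign_insert_of_lt hj h, posSign_insert_of_le h.le]; ring

lemma posSign_erase_mul {i j : Fin m} {J : Finset (Fin m)} (hij : i ≠ j) (hi : i ∈ J)
    (hj : j ∈ J) :
    posSign j J * posSign i (J.erase j) = - (posSign i J * posSign j (J.erase i)) := by
  have hiK : i ∉ (J.erase j).erase i := by simp
  have hjK : j ∉ (J.erase j).erase i := by simp
  have h1 : J.erase j = insert i ((J.erase j).erase i) := by
    rw [Finset.insert_erase]; simp [hij, hi]
  have h2 : J.erase i = insert j ((J.erase j).erase i) := by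
    rw [Finset.erase_right_comm, Finset.insert_erase]; simp [hij.symm, hj]
  have h3 : J = insert j (insert i ((J.erase j).erase i)) := by
    rw [← h1, Finset.insert_erase hj]
  have h4 : posSign j J = posSign j (insert i ((J.erase j).erase i)) := by
    conv_lhs => rw [h3]
    exact posSign_insert_of_le le_rfl
  have h5 : posSign i J = posSign i (insert j ((J.erase j).erase i)) := by
    conv_lhs => rw [h3, Finset.insert_comm]
    exact posSign_insert_of_le le_rfl
  have h6 : posSign i (J.erase j) = posSign i ((J.erase j).erase i) := by
    conv_lhs => rw [h1]
    exact posSign_insert_of_le le_rfl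
  have h7 : posSign j (J.erase i) = posSign j ((J.erase j).erase i) := by
    conv_lhs => rw [h2]
    exact posSign_insert_of_le le_rfl
  rw [h4, h5, h6, h7]
  exact posSign_insert_mul hij hiK hjK

variable {V : Type*} [AddCommGroup V]

/-- The alternating sum differential on families indexed by all finite subsets. -/
def altDiff : (Finset (Fin m) → V) →+ (Finset (Fin m) → V) where
  toFun γ J := ∑ j ∈ J, posSign j J • γ (J.erase j)
  map_zero' := by funext J; simp
  map_add' γ γ' := by funext J; simp [Finset.sum_add_distrib]

lemma altDiff_apply (γ : Finset (Fin m) → V) (J : Finset (Fin m)) :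
    altDiff γ J = ∑ j ∈ J, posSign j J • γ (J.erase j) := rfl

/-- Removing two elements in either order leaves the same set with opposite signs, so exchanging
them is a sign-reversing involution on the terms. -/
lemma altDiff_altDiff (γ : Finset (Fin m) → V) : altDiff (altDiff γ) = 0 := by
  funext J
  simp only [altDiff_apply, Finset.smul_sum, smul_smul, Pi.zero_apply]
  rw [Finset.sum_sigma']
  refine Finset.sum_involution (fun x _ => ⟨x.2, x.1⟩) ?_ ?_ ?_ ?_
  · rintro ⟨j, i⟩ h
    simp only [Finset.mem_sigma, Finset.mem_erase] at h
    obtain ⟨hj, hij, hi⟩ := h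
    simp only
    rw [posSign_erase_mul hij hi hj, Finset.erase_right_comm, neg_smul, neg_add_cancel]
  · rintro ⟨j, i⟩ h _ heq
    simp only [Finset.mem_sigma, Finset.mem_erase] at h
    simp only [Sigma.mk.injEq, heq_eq_eq] at heq
    exact h.2.1 heq.1
  · rintro ⟨j, i⟩ h
    simp only [Finset.mem_sigma, Finset.mem_erase] at h ⊢
    exact ⟨h.2.2, h.2.1.symm, h.1⟩
  · rintro ⟨j, i⟩ _; rfl

lemma map_altDiff {W : Type*} [AddCommGroup W] (φ : V →+ W) (γ : Finset (Fin m) → V)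
    (J : Finset (Fin m)) : φ (altDiff γ J) = altDiff (fun I => φ (γ I)) J := by
  simp only [altDiff_apply, map_sum, map_zsmul]

/-- The contraction of the alternating complex along `i`. -/
def contract (i : Fin m) (γ : Finset (Fin m) → V) (J : Finset (Fin m)) : V :=
  if i ∈ J then 0 else posSign i J • γ (insert i J)

/-- Contraction is a null-homotopy of the identity. It moves elements from `R_{J ∪ {i}}` to `R_J`,
so on Čech cochains it is usable only on monomials with nonnegative `i`-th exponent. -/
lemma altDiff_contract (i : Fin m) (γ : Finset (Fin m) → V) (J : Finset (Fin m)) :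
    altDiff (contract i γ) J + contract i (altDiff γ) J = γ J := by
  by_cases hi : i ∈ J
  · rw [altDiff_apply, contract, if_pos hi, add_zero, Finset.sum_eq_single_of_mem i hi]
    · rw [contract, if_neg (by simp), Finset.insert_erase hi, smul_smul]
      have : posSign i (J.erase i) = posSign i J := by
        conv_rhs => rw [← Finset.insert_erase hi, posSign_insert_of_le le_rfl]
      rw [this, posSign_mul_self, one_smul]
    · intro j _ hji
      rw [contract, if_pos (by simp [hji.symm, hi]), smul_zero]
  · rw [contract, if_neg hi, altDiff_apply, altDiff_apply, Finset.sum_insert hi,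
      Finset.erase_insert hi, smul_add, smul_smul, posSign_insert_of_le le_rfl, posSign_mul_self,
      one_smul, add_left_comm, Finset.smul_sum, ← Finset.sum_add_distrib, Finset.sum_eq_zero,
      add_zero]
    intro j hj
    have hij : i ≠ j := fun h => hi (h ▸ hj)
    rw [contract, if_neg (by simp [hi]), Finset.erase_insert_of_ne hij, smul_smul, smul_smul,
      ← add_smul]
    have h1 : insert j (J.erase j) = J := Finset.insert_erase hj
    have h2 : posSign j J = posSign j (J.erase j) := by
      conv_lhs => rw [← h1, posSign_insert_of_le le_rfl]
    have h3 := posSign_insert_mul (J := J.erase j) hij (by simp [hi]) (by simp)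
    rw [h1] at h3
    have h4 : posSign j (insert i J) = posSign j (insert i (J.erase j)) := by
      conv_lhs => rw [← h1, Finset.insert_comm, posSign_insert_of_le le_rfl]
    rw [h2, h4, mul_comm (posSign i J), mul_comm (posSign j (J.erase j))]
    have h5 := posSign_mul_self i J
    have h6 := posSign_mul_self i (J.erase j)
    have h7 : posSign i (J.erase j) * posSign j (J.erase j) +
        posSign j (insert i (J.erase j)) * posSign i J = 0 := by
      linear_combination posSign i J * posSign i (J.erase j) * h3 -
        posSign i J * posSign j (insert i (J.erase j)) * h6 -
        posSign i (J.erase j) * posSign j (J.erase j) * h5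
    rw [h7, zero_smul]

end Alternating

/-! ### Laurent polynomials and integration of Čech cocycles -/

section Laurent

variable {k : Type u} [Field k] {n : ℕ}

/-- Laurent polynomials in `n + 1` variables. -/
abbrev Laurent (k : Type u) [Field k] (n : ℕ) : Type u := AddMonoidAlgebra k (Fin (n + 1) → ℤ)

/-- The exponents of monomials, as integers. -/
def expInt (n : ℕ) : (Fin (n + 1) →₀ ℕ) →+ (Fin (n + 1) → ℤ) where
  toFun a i := a i
  map_zero' := by funext i; simp
  map_add' a b := by funext i; simp

lemma expInt_apply (a : Fin (n + 1) →₀ ℕ) (i : Fin (n + 1)) : expInt n a i = a i := rfl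

lemma expInt_injective : Function.Injective (expInt n) := by
  intro a b h
  ext i
  have := congrFun h i
  simpa [expInt_apply] using this

lemma exists_expInt_eq {z : Fin (n + 1) → ℤ} (hz : ∀ i, 0 ≤ z i) : ∃ a, expInt n a = z :=
  ⟨Finsupp.equivFunOnFinite.symm fun i => (z i).toNat, funext fun i => Int.toNat_of_nonneg (hz i)⟩

/-- The inclusion of polynomials into Laurent polynomials. -/
def toL (k : Type u) [Field k] (n : ℕ) : Poly k n →+* Laurent k n :=
  AddMonoidAlgebra.mapDomainRingHom k (expInt n)

lemma toL_injective : Function.Injective (toL k n) :=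
  AddMonoidAlgebra.mapDomain_injective expInt_injective

@[simp] lemma coeff_toL (g : Poly k n) (a : Fin (n + 1) →₀ ℕ) :
    (toL k n g).coeff (expInt n a) = MvPolynomial.coeff a g :=
  Finsupp.mapDomain_apply expInt_injective _ _

lemma exists_of_coeff_toL_ne_zero {g : Poly k n} {z : Fin (n + 1) → ℤ}
    (h : (toL k n g).coeff z ≠ 0) : ∃ a, expInt n a = z := by
  by_contra hz
  exact h (Finsupp.mapDomain_of_notMem_range _ _ hz)

lemma nonneg_of_coeff_toL_ne_zero {g : Poly k n} {z : Fin (n + 1) → ℤ}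
    (h : (toL k n g).coeff z ≠ 0) (i : Fin (n + 1)) : 0 ≤ z i := by
  obtain ⟨a, rfl⟩ := exists_of_coeff_toL_ne_zero h
  rw [expInt_apply]; positivity

lemma exists_toL_eq {l : Laurent k n} (h : ∀ z, l.coeff z ≠ 0 → ∀ i, 0 ≤ z i) :
    ∃ g, toL k n g = l := by
  refine ⟨AddMonoidAlgebra.comapDomain _ expInt_injective l, ?_⟩
  ext z
  by_cases hz : ∃ a, expInt n a = z
  · obtain ⟨a, rfl⟩ := hz
    rw [coeff_toL]; rfl
  · have h1 : l.coeff z = 0 := by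
      by_contra h1
      exact hz (exists_expInt_eq (h z h1))
    rw [h1]
    by_contra h2
    exact hz (exists_of_coeff_toL_ne_zero h2)

/-- The Laurent monomial with exponent `z`. -/
def mono (k : Type u) [Field k] {n : ℕ} (z : Fin (n + 1) → ℤ) : Laurent k n :=
  AddMonoidAlgebra.single z 1

lemma mono_mul (z w : Fin (n + 1) → ℤ) : mono k z * mono k w = mono k (z + w) := by
  rw [mono, mono, AddMonoidAlgebra.single_mul_single, mul_one]; rfl

lemma mono_zero : mono k (0 : Fin (n + 1) → ℤ) = 1 := rfl

lemma mono_pow (z : Fin (n + 1) → ℤ) (N : ℕ) : mono k z ^ N = mono k (N • z) := by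
  rw [mono, AddMonoidAlgebra.single_pow, one_pow]; rfl

lemma mono_mul_neg (z : Fin (n + 1) → ℤ) : mono k z * mono k (-z) = 1 := by
  rw [mono_mul, add_neg_cancel, mono_zero]

lemma isUnit_mono (z : Fin (n + 1) → ℤ) : IsUnit (mono k z) :=
  IsUnit.of_mul_eq_one _ (mono_mul_neg z)

lemma coeff_mul_mono (l : Laurent k n) (z w : Fin (n + 1) → ℤ) :
    (l * mono k z).coeff w = l.coeff (w - z) := by
  rw [mono, AddMonoidAlgebra.coeff_mul_single_apply, mul_one, sub_eq_add_neg]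

/-- The indicator exponent of a set of variables. -/
def indExp (I : Finset (Fin (n + 1))) : Fin (n + 1) → ℤ := fun i => if i ∈ I then 1 else 0

lemma toL_monomial (a : Fin (n + 1) →₀ ℕ) :
    toL k n (MvPolynomial.monomial a 1) = mono k (expInt n a) :=
  AddMonoidAlgebra.mapDomain_single

lemma toL_prod_X (I : Finset (Fin (n + 1))) :
    toL k n (∏ i ∈ I, MvPolynomial.X i) = mono k (indExp I) := by
  induction I using Finset.induction_on with
  | empty => rw [Finset.prod_empty, map_one]; rfl
  | insert i I hi ih =>
    rw [Finset.prod_insert hi, map_mul, ih, MvPolynomial.X, toL_monomial, mono_mul]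
    congr 1
    funext j
    rw [Pi.add_apply, expInt_apply, indExp, indExp, Finsupp.single_apply]
    by_cases h : i = j
    · subst h; simp [hi]
    · simp [h, Ne.symm h]

open Classical in
/-- The part of a Laurent polynomial with exponents satisfying `P`. -/
def trunc (P : (Fin (n + 1) → ℤ) → Prop) : Laurent k n →+ Laurent k n where
  toFun l := AddMonoidAlgebra.ofCoeff (l.coeff.filter P)
  map_zero' := by ext; simp [Finsupp.filter_apply]
  map_add' l l' := by ext z; simp [Finsupp.filter_apply, ite_add_ite]

open Classical in
lemma coeff_trunc (P : (Fin (n + 1) → ℤ) → Prop) (l : Laurent k n) (z : Fin (n + 1) → ℤ) :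
    (trunc P l).coeff z = if P z then l.coeff z else 0 := Finsupp.filter_apply _ _ _

lemma coeff_trunc_ne_zero {P : (Fin (n + 1) → ℤ) → Prop} {l : Laurent k n} {z : Fin (n + 1) → ℤ}
    (h : (trunc P l).coeff z ≠ 0) : P z ∧ l.coeff z ≠ 0 := by
  rw [coeff_trunc] at h
  split_ifs at h with hP
  · exact ⟨hP, h⟩
  · exact absurd rfl h

lemma trunc_eq_self {P : (Fin (n + 1) → ℤ) → Prop} {l : Laurent k n}
    (h : ∀ z, l.coeff z ≠ 0 → P z) : trunc P l = l := by
  ext z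
  rw [coeff_trunc]
  split_ifs with hP
  · rfl
  · by_contra h0
    exact hP (h z (Ne.symm h0))

/-- The family `γ` of Laurent polynomials has its component at `J` in `R_J` for all `J`. -/
def IsLocFamily (γ : Finset (Fin (n + 1)) → Laurent k n) : Prop :=
  ∀ J z, (γ J).coeff z ≠ 0 → ∀ j ∉ J, 0 ≤ z j

lemma coeff_zsmul_ne_zero {a : ℤ} {l : Laurent k n} {z : Fin (n + 1) → ℤ}
    (h : (a • l).coeff z ≠ 0) : l.coeff z ≠ 0 := by
  intro h0
  apply h
  rw [AddMonoidAlgebra.coeff_smul_apply, h0, smul_zero]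

lemma exists_of_coeff_sum_ne_zero {ι : Type*} {s : Finset ι} {l : ι → Laurent k n}
    {z : Fin (n + 1) → ℤ} (h : (∑ i ∈ s, l i).coeff z ≠ 0) : ∃ i ∈ s, (l i).coeff z ≠ 0 := by
  rw [AddMonoidAlgebra.coeff_sum, Finsupp.finsetSum_apply] at h
  exact Finset.exists_ne_zero_of_sum_ne_zero h

lemma altDiff_coeff_ne_zero {γ : Finset (Fin (n + 1)) → Laurent k n} {J : Finset (Fin (n + 1))}
    {z : Fin (n + 1) → ℤ} (h : (altDiff γ J).coeff z ≠ 0) :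
    ∃ j ∈ J, (γ (J.erase j)).coeff z ≠ 0 := by
  rw [altDiff_apply] at h
  obtain ⟨j, hj, h⟩ := exists_of_coeff_sum_ne_zero h
  exact ⟨j, hj, coeff_zsmul_ne_zero h⟩

/-- A cocycle of the Čech complex of the polynomial ring, in which every monomial has some
nonnegative exponent, is a coboundary. -/
lemma exists_altDiff_eq {q : ℕ} {γ : Finset (Fin (n + 1)) → Laurent k n} (hloc : IsLocFamily γ)
    (hq : ∀ J, J.card ≠ q → γ J = 0) (hγ : altDiff γ = 0)
    (hneg : ∀ J z, (γ J).coeff z ≠ 0 → ∃ i, 0 ≤ z i) :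
    ∃ η : Finset (Fin (n + 1)) → Laurent k n, IsLocFamily η ∧
      (∀ J, J.card + 1 ≠ q → η J = 0) ∧ altDiff η = γ := by
  -- The variables are treated one at a time: modulo coboundaries, only monomials negative at every
  -- index of `S` survive.
  have key (S : Finset (Fin (n + 1))) : ∃ η : Finset (Fin (n + 1)) → Laurent k n,
      IsLocFamily η ∧ (∀ J, J.card + 1 ≠ q → η J = 0) ∧
      ∀ J, altDiff η J = γ J - trunc (fun z => ∀ i ∈ S, z i < 0) (γ J) := by
    induction S using Finset.induction_on with
    | empty =>
      refine ⟨0, fun J z h => absurd rfl h, fun _ _ => rfl, fun J => ?_⟩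
      rw [trunc_eq_self (by simp), map_zero, sub_self]; rfl
    | insert i S _ ih =>
      obtain ⟨η, h1, h2, h3⟩ := ih
      -- These are the monomials discarded when passing from `S` to `insert i S`. Their `i`-th
      -- exponent is nonnegative, so contraction along `i` keeps them in the required localizations.
      let P : (Fin (n + 1) → ℤ) → Prop := fun z => (∀ i ∈ S, z i < 0) ∧ 0 ≤ z i
      let γ' : Finset (Fin (n + 1)) → Laurent k n := fun J => trunc P (γ J)
      have hγ' : altDiff γ' = 0 := by
        funext J
        rw [← map_altDiff, hγ, Pi.zero_apply, map_zero]
      refine ⟨η + contract i γ', ?_, fun J hJ => ?_, fun J => ?_⟩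
      · intro J z hz j hj
        by_cases hη : (η J).coeff z = 0
        · have h4 : (contract i γ' J).coeff z ≠ 0 := fun h => hz (by
            rw [Pi.add_apply, AddMonoidAlgebra.coeff_add, Finsupp.add_apply, hη, h, add_zero])
          rw [contract] at h4
          split_ifs at h4 with hi
          · exact absurd rfl h4
          · obtain ⟨h5, h6⟩ := coeff_trunc_ne_zero (coeff_zsmul_ne_zero h4)
            by_cases hji : j = i
            · rw [hji]; exact h5.2
            · exact hloc _ _ h6 j (by simp [hji, hj])
        · exact h1 J z hη j hj
      · rw [Pi.add_apply, h2 J hJ, zero_add, contract]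
        split_ifs with hi
        · rfl
        · simp only [γ']
          rw [hq _ (by rwa [Finset.card_insert_of_notMem hi]), map_zero, smul_zero]
      · have h4 := altDiff_contract i γ' J
        have h5 : contract i (altDiff γ') J = 0 := by rw [hγ', contract]; simp
        rw [h5, add_zero] at h4
        rw [map_add, Pi.add_apply, h3, h4]
        ext z
        simp only [γ', P, AddMonoidAlgebra.coeff_add, AddMonoidAlgebra.coeff_sub, Finsupp.add_apply,
          Finsupp.sub_apply, coeff_trunc, Finset.forall_mem_insert]
        by_cases ha : ∀ i ∈ S, z i < 0 <;> by_cases hb : z i < 0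
        · rw [if_pos ha, if_neg fun h => absurd h.2 (not_le.mpr hb), if_pos ⟨hb, ha⟩]; simp
        · rw [if_pos ha, if_pos ⟨ha, not_lt.mp hb⟩, if_neg fun h => hb h.1]; simp
        · rw [if_neg ha, if_neg fun h => ha h.1, if_neg fun h => ha h.2]; simp
        · rw [if_neg ha, if_neg fun h => ha h.1, if_neg fun h => ha h.2]; simp
  obtain ⟨η, h1, h2, h3⟩ := key Finset.univ
  refine ⟨η, h1, h2, funext fun J => ?_⟩
  rw [h3, sub_eq_self]
  ext z
  rw [coeff_trunc]
  split_ifs with h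
  · by_contra h0
    obtain ⟨i, hi⟩ := hneg J z h0
    exact absurd (h i (Finset.mem_univ i)) (not_lt.mpr hi)
  · rfl

end Laurent

/-! ### The Čech complex of the polynomial ring -/

section

open MvPolynomial

variable {k : Type u} [Field k] {n : ℕ}

/-- The variables of the polynomial ring, as a sequence of elements. -/
abbrev polyVar (k : Type u) [Field k] (n : ℕ) : Fin (n + 1) → Poly k n := X

section LocToLaurent

/-- The embedding of `R_I` into Laurent polynomials. -/
def locL (I : Finset (Fin (n + 1))) : Loc (polyVar k n) I →+* Laurent k n :=
  IsLocalization.Away.lift (S := Loc (polyVar k n) I) (g := toL k n) (∏ i ∈ I, polyVar k n i)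
    (by rw [toL_prod_X]; exact isUnit_mono _)

@[simp] lemma locL_algebraMap (I : Finset (Fin (n + 1))) (g : Poly k n) :
    locL I (algebraMap _ _ g) = toL k n g := IsLocalization.Away.lift_eq _ _ g

lemma locL_res {I J : Finset (Fin (n + 1))} (h : I ⊆ J) (z : Loc (polyVar k n) I) :
    locL J (res _ h z) = locL I z := by
  have : (locL J).comp (res (polyVar k n) h) = locL I :=
    IsLocalization.ringHom_ext (Submonoid.powers (∏ i ∈ I, polyVar k n i)) (by
      refine RingHom.ext fun g => ?_
      simp [res_algebraMap])
  exact RingHom.congr_fun this z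

lemma exists_locL_mul_mono (I : Finset (Fin (n + 1))) (z : Loc (polyVar k n) I) :
    ∃ (N : ℕ) (g : Poly k n),
      z * algebraMap _ _ (∏ i ∈ I, polyVar k n i) ^ N = algebraMap _ _ g ∧
      locL I z * mono k (N • indExp I) = toL k n g := by
  obtain ⟨N, g, h⟩ := IsLocalization.Away.surj (S := Loc (polyVar k n) I)
    (∏ i ∈ I, polyVar k n i) z
  refine ⟨N, g, h, ?_⟩
  rw [← locL_algebraMap I, ← h, map_mul, map_pow, locL_algebraMap, toL_prod_X, mono_pow]

lemma locL_injective (I : Finset (Fin (n + 1))) :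
    Function.Injective (locL (k := k) I) := by
  rw [injective_iff_map_eq_zero]
  intro z hz
  obtain ⟨N, g, h1, h2⟩ := exists_locL_mul_mono I z
  rw [hz, zero_mul, ← map_zero (toL k n)] at h2
  rw [← toL_injective h2, map_zero] at h1
  have hu : IsUnit (algebraMap (Poly k n) (Loc (polyVar k n) I) (∏ i ∈ I, polyVar k n i) ^ N) :=
    (IsLocalization.Away.algebraMap_isUnit _).pow N
  exact (hu.mul_left_eq_zero).mp h1

lemma nsmul_indExp_apply (N : ℕ) (I : Finset (Fin (n + 1))) (j : Fin (n + 1)) :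
    (N • indExp I) j = if j ∈ I then (N : ℤ) else 0 := by
  simp [indExp]

lemma nonneg_of_coeff_locL_ne_zero {I : Finset (Fin (n + 1))} {z : Loc (polyVar k n) I}
    {w : Fin (n + 1) → ℤ} (hw : (locL I z).coeff w ≠ 0) {j : Fin (n + 1)} (hj : j ∉ I) :
    0 ≤ w j := by
  obtain ⟨N, g, -, h⟩ := exists_locL_mul_mono I z
  have h1 : (toL k n g).coeff (w + N • indExp I) ≠ 0 := by
    rwa [← h, coeff_mul_mono, add_sub_cancel_right]
  have := nonneg_of_coeff_toL_ne_zero h1 j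
  rwa [Pi.add_apply, nsmul_indExp_apply, if_neg hj, add_zero] at this

/-- Finitely many exponents are bounded from below. -/
lemma exists_nat_bound (l : Laurent k n) :
    ∃ N : ℕ, ∀ w, l.coeff w ≠ 0 → ∀ i, -(N : ℤ) ≤ w i := by
  refine ⟨∑ w ∈ l.coeff.support, ∑ i, (w i).natAbs, fun w hw i => ?_⟩
  have h1 : (w i).natAbs ≤ ∑ i, (w i).natAbs :=
    Finset.single_le_sum (f := fun i => (w i).natAbs) (fun _ _ => Nat.zero_le _) (Finset.mem_univ i)
  have h2 : ∑ i, (w i).natAbs ≤ ∑ w ∈ l.coeff.support, ∑ i, (w i).natAbs :=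
    Finset.single_le_sum (f := fun w : Fin (n + 1) → ℤ => ∑ i, (w i).natAbs)
      (fun _ _ => Nat.zero_le _) (Finsupp.mem_support_iff.mpr hw)
  omega

/-- A high power of `∏ i ∈ I, x_i` clears the negative exponents. With
`nonneg_of_coeff_locL_ne_zero`, this determines the image of `R_I`. -/
lemma exists_locL_eq {I : Finset (Fin (n + 1))} {l : Laurent k n}
    (h : ∀ w, l.coeff w ≠ 0 → ∀ j ∉ I, 0 ≤ w j) : ∃ z, locL I z = l := by
  obtain ⟨N, hN⟩ := exists_nat_bound l
  obtain ⟨g, hg⟩ := exists_toL_eq (l := l * mono k (N • indExp I)) (by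
    intro w hw i
    rw [coeff_mul_mono] at hw
    by_cases hi : i ∈ I
    · have := hN _ hw i
      rw [Pi.sub_apply, nsmul_indExp_apply, if_pos hi] at this
      omega
    · have := h _ hw i hi
      rwa [Pi.sub_apply, nsmul_indExp_apply, if_neg hi, sub_zero] at this)
  have hu : IsUnit (algebraMap (Poly k n) (Loc (polyVar k n) I) (∏ i ∈ I, polyVar k n i) ^ N) :=
    (IsLocalization.Away.algebraMap_isUnit _).pow N
  obtain ⟨v, hv⟩ := hu.exists_right_inv
  refine ⟨algebraMap _ _ g * v, ?_⟩
  have hv' := congrArg (locL I) hv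
  rw [map_mul, map_pow, locL_algebraMap, toL_prod_X, mono_pow, map_one] at hv'
  rw [map_mul, locL_algebraMap, hg, mul_assoc, hv', mul_one]

end LocToLaurent

section Cochain

/-- The family of Laurent polynomials underlying a Čech cochain of the polynomial ring. -/
def cochainL {q : ℕ} (c : Cochain (polyVar k n) q) (J : Finset (Fin (n + 1))) : Laurent k n :=
  if h : J.card = q then locL J (c ⟨J, h⟩) else 0

lemma cochainL_of_card {q : ℕ} (c : Cochain (polyVar k n) q) {J : Finset (Fin (n + 1))}
    (h : J.card = q) : cochainL c J = locL J (c ⟨J, h⟩) := dif_pos h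

lemma cochainL_of_card_ne {q : ℕ} (c : Cochain (polyVar k n) q) {J : Finset (Fin (n + 1))}
    (h : J.card ≠ q) : cochainL c J = 0 := dif_neg h

lemma isLocFamily_cochainL {q : ℕ} (c : Cochain (polyVar k n) q) : IsLocFamily (cochainL c) := by
  intro J z hz j hj
  by_cases h : J.card = q
  · rw [cochainL_of_card c h] at hz
    exact nonneg_of_coeff_locL_ne_zero hz hj
  · rw [cochainL_of_card_ne c h] at hz
    exact absurd rfl hz

lemma cochainL_add {q : ℕ} (c c' : Cochain (polyVar k n) q) :
    cochainL (c + c') = cochainL c + cochainL c' := by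
  funext J
  by_cases h : J.card = q
  · simp only [Pi.add_apply, cochainL_of_card _ h, map_add]
  · simp only [Pi.add_apply, cochainL_of_card_ne _ h, add_zero]

lemma cochainL_smul {q : ℕ} (g : Poly k n) (c : Cochain (polyVar k n) q)
    (J : Finset (Fin (n + 1))) : cochainL (g • c) J = toL k n g * cochainL c J := by
  by_cases h : J.card = q
  · rw [cochainL_of_card _ h, cochainL_of_card _ h]
    change locL J (g • c ⟨J, h⟩) = _
    rw [Algebra.smul_def, map_mul, locL_algebraMap]
  · simp only [cochainL_of_card_ne _ h, mul_zero]

lemma cochainL_injective {q : ℕ} :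
    Function.Injective (cochainL : Cochain (polyVar k n) q → _) := by
  intro c c' h
  funext ⟨J, hJ⟩
  have := congrFun h J
  rw [cochainL_of_card c hJ, cochainL_of_card c' hJ] at this
  exact locL_injective J this

lemma exists_cochainL_eq {q : ℕ} {γ : Finset (Fin (n + 1)) → Laurent k n} (h : IsLocFamily γ)
    (hq : ∀ J, J.card ≠ q → γ J = 0) : ∃ c : Cochain (polyVar k n) q, cochainL c = γ := by
  choose c hc using fun J => exists_locL_eq (h J)
  refine ⟨fun J => c J.1, funext fun J => ?_⟩
  by_cases hJ : J.card = q
  · rw [cochainL_of_card _ hJ, hc]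
  · rw [cochainL_of_card_ne _ hJ, hq J hJ]

lemma cochainL_diff {q : ℕ} (c : Cochain (polyVar k n) q) :
    cochainL (diff _ q c) = altDiff (cochainL c) := by
  funext J
  by_cases hJ : J.card = q + 1
  · rw [cochainL_of_card _ hJ, altDiff_apply, ← Finset.sum_coe_sort]
    simp only [diff, LinearMap.coe_mk, AddHom.coe_mk, map_sum, map_mul, map_pow, map_neg, map_one]
    refine Finset.sum_congr rfl fun j _ => ?_
    have hj : (J.erase j.1).card = q := by rw [Finset.card_erase_of_mem j.2, hJ]; rfl
    rw [cochainL_of_card _ hj, locL_res, posSign, zsmul_eq_mul]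
    push_cast
    rfl
  · rw [cochainL_of_card_ne _ hJ, altDiff_apply, Finset.sum_eq_zero]
    intro j hj
    rw [cochainL_of_card_ne, smul_zero]
    rw [Finset.card_erase_of_mem hj]
    have := Finset.card_pos.mpr ⟨j, hj⟩
    omega

/-- The Čech cohomology of the polynomial ring vanishes below the top degree. -/
lemma mem_coboundaries_of_altDiff_eq_zero {q : ℕ} (hq : q ≤ n) {c : Cochain (polyVar k n) q}
    (hc : altDiff (cochainL c) = 0) : c ∈ coboundaries (polyVar k n) q := by
  obtain ⟨η, h1, h2, h3⟩ := exists_altDiff_eq (isLocFamily_cochainL c)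
    (fun J hJ => cochainL_of_card_ne c hJ) hc (by
      intro J z hz
      by_cases hJ : J.card = q
      · have : ∃ i, i ∉ J := by
          by_contra! h
          rw [Finset.eq_univ_of_forall h, Finset.card_univ, Fintype.card_fin] at hJ
          omega
        obtain ⟨i, hi⟩ := this
        exact ⟨i, isLocFamily_cochainL c J z hz i hi⟩
      · rw [cochainL_of_card_ne c hJ] at hz
        exact absurd rfl hz)
  cases q with
  | zero =>
    have : η = 0 := funext fun J => h2 J (Nat.succ_ne_zero _)
    rw [this, map_zero] at h3
    have h4 : cochainL (0 : Cochain (polyVar k n) 0) = 0 := by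
      funext J; simp [cochainL]
    exact cochainL_injective (h3.symm.trans h4.symm)
  | succ q =>
    obtain ⟨b, rfl⟩ := exists_cochainL_eq h1 (q := q) fun J hJ => h2 J (by omega)
    exact ⟨b, cochainL_injective (by rw [cochainL_diff, h3])⟩

end Cochain

/-! ### Reduction modulo `f` -/

section Reduction

variable (f : Poly k n)

/-- The reduction map `R_I → (R/fR)_I`. -/
def locHyp (I : Finset (Fin (n + 1))) : Loc (polyVar k n) I →+* Loc (hypVar f) I :=
  IsLocalization.Away.lift (S := Loc (polyVar k n) I)
    (g := (algebraMap (Hyp f) (Loc (hypVar f) I)).comp (Ideal.Quotient.mk (Ideal.span {f})))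
    (∏ i ∈ I, polyVar k n i) (by
      rw [RingHom.comp_apply, map_prod]
      exact IsLocalization.Away.algebraMap_isUnit (∏ i ∈ I, hypVar f i))

@[simp] lemma locHyp_algebraMap (I : Finset (Fin (n + 1))) (g : Poly k n) :
    locHyp f I (algebraMap _ _ g) =
      algebraMap (Hyp f) (Loc (hypVar f) I) (Ideal.Quotient.mk _ g) :=
  IsLocalization.Away.lift_eq _ _ g

lemma mk_prod_polyVar (I : Finset (Fin (n + 1))) :
    Ideal.Quotient.mk (Ideal.span {f}) (∏ i ∈ I, polyVar k n i) = ∏ i ∈ I, hypVar f i :=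
  map_prod _ _ _

lemma locHyp_res {I J : Finset (Fin (n + 1))} (h : I ⊆ J) (z : Loc (polyVar k n) I) :
    locHyp f J (res _ h z) = res _ h (locHyp f I z) := by
  have : (locHyp f J).comp (res (polyVar k n) h) = (res (hypVar f) h).comp (locHyp f I) :=
    IsLocalization.ringHom_ext (Submonoid.powers (∏ i ∈ I, polyVar k n i)) (by
      refine RingHom.ext fun g => ?_
      simp [res_algebraMap])
  exact RingHom.congr_fun this z

lemma locHyp_surjective (I : Finset (Fin (n + 1))) : Function.Surjective (locHyp f I) := by
  intro y
  obtain ⟨N, a, h⟩ := IsLocalization.Away.surj (S := Loc (hypVar f) I) (∏ i ∈ I, hypVar f i) y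
  obtain ⟨g, rfl⟩ := Ideal.Quotient.mk_surjective a
  have hu : IsUnit (algebraMap (Poly k n) (Loc (polyVar k n) I) (∏ i ∈ I, polyVar k n i) ^ N) :=
    (IsLocalization.Away.algebraMap_isUnit _).pow N
  obtain ⟨v, hv⟩ := hu.exists_right_inv
  refine ⟨algebraMap _ _ g * v, ?_⟩
  have hv' := congrArg (locHyp f I) hv
  rw [map_mul, map_pow, locHyp_algebraMap, mk_prod_polyVar, map_one] at hv'
  rw [map_mul, locHyp_algebraMap, ← h, mul_assoc, hv', mul_one]

/-- This is exactness of `R_I → R_I → (R/fR)_I` in the middle: a multiple of the numerator by a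
power of the inverted variables lies in `fR`. -/
lemma exists_eq_smul_of_locHyp_eq_zero {I : Finset (Fin (n + 1))} {z : Loc (polyVar k n) I}
    (hz : locHyp f I z = 0) : ∃ y, z = f • y := by
  obtain ⟨N, g, h, -⟩ := exists_locL_mul_mono I z
  have h1 := congrArg (locHyp f I) h
  rw [map_mul, hz, zero_mul, locHyp_algebraMap, eq_comm,
    IsLocalization.map_eq_zero_iff (Submonoid.powers (∏ i ∈ I, hypVar f i))] at h1
  obtain ⟨⟨_, M, rfl⟩, h1⟩ := h1
  simp only [← mk_prod_polyVar, ← map_pow, ← map_mul] at h1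
  rw [Ideal.Quotient.eq_zero_iff_mem, Ideal.mem_span_singleton] at h1
  obtain ⟨b, hb⟩ := h1
  have hu : IsUnit
      (algebraMap (Poly k n) (Loc (polyVar k n) I) (∏ i ∈ I, polyVar k n i) ^ (N + M)) :=
    (IsLocalization.Away.algebraMap_isUnit _).pow _
  obtain ⟨v, hv⟩ := hu.exists_right_inv
  refine ⟨algebraMap _ _ b * v, ?_⟩
  rw [Algebra.smul_def, ← mul_assoc, ← map_mul, ← hb, map_mul, ← h, map_pow]
  linear_combination (-z) * hv

/-- The reduction map on Čech cochains. -/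
def cochainHyp {q : ℕ} : Cochain (polyVar k n) q →+ Cochain (hypVar f) q where
  toFun c I := locHyp f I.1 (c I)
  map_zero' := by funext I; exact map_zero _
  map_add' c c' := by funext I; exact map_add _ _ _

lemma cochainHyp_apply {q : ℕ} (c : Cochain (polyVar k n) q) (I) :
    cochainHyp f c I = locHyp f I.1 (c I) := rfl

lemma cochainHyp_surjective {q : ℕ} :
    Function.Surjective (cochainHyp f : Cochain (polyVar k n) q →+ _) := by
  intro c
  choose b hb using fun I : {I : Finset (Fin (n + 1)) // I.card = q} =>
    locHyp_surjective f I.1 (c I)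
  exact ⟨b, funext hb⟩

lemma cochainHyp_smul {q : ℕ} (c : Cochain (polyVar k n) q) : cochainHyp f (f • c) = 0 := by
  funext I
  rw [cochainHyp_apply, Pi.smul_apply, Algebra.smul_def, map_mul, locHyp_algebraMap,
    Ideal.Quotient.eq_zero_iff_mem.mpr (Ideal.mem_span_singleton_self f), map_zero, zero_mul]
  rfl

lemma exists_eq_smul_of_cochainHyp_eq_zero {q : ℕ} {c : Cochain (polyVar k n) q}
    (h : cochainHyp f c = 0) : ∃ b : Cochain (polyVar k n) q, c = f • b := by
  choose b hb using fun I => exists_eq_smul_of_locHyp_eq_zero f (congrFun h I)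
  exact ⟨b, funext hb⟩

lemma diff_cochainHyp {q : ℕ} (c : Cochain (polyVar k n) q) :
    diff _ q (cochainHyp f c) = cochainHyp f (diff _ q c) := by
  funext J
  simp only [diff, cochainHyp_apply, LinearMap.coe_mk, AddHom.coe_mk, map_sum, map_mul, map_pow,
    map_neg, map_one, locHyp_res]

lemma cochainHyp_mem_coboundaries {q : ℕ} {c : Cochain (polyVar k n) q}
    (hc : c ∈ coboundaries _ q) : cochainHyp f c ∈ coboundaries (hypVar f) q := by
  cases q with
  | zero =>
    have h : c = 0 := hc
    rw [h, map_zero]; exact Submodule.zero_mem _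
  | succ q =>
    obtain ⟨b, rfl⟩ := hc
    exact ⟨cochainHyp f b, diff_cochainHyp f b⟩

/-- Lifting a primitive and then applying the differential gives a lift that is an honest cocycle;
an arbitrary lift is a cocycle only modulo `f`. -/
lemma exists_of_mem_coboundaries {q : ℕ} {c : Cochain (hypVar f) q}
    (hc : c ∈ coboundaries (hypVar f) q) :
    ∃ b : Cochain (polyVar k n) q, cochainHyp f b = c ∧ altDiff (cochainL b) = 0 := by
  cases q with
  | zero =>
    have h : c = 0 := hc
    refine ⟨0, by rw [h, map_zero], ?_⟩
    have h4 : cochainL (0 : Cochain (polyVar k n) 0) = 0 := by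
      funext J; simp [cochainL]
    rw [h4, map_zero]
  | succ q =>
    obtain ⟨b, rfl⟩ := hc
    obtain ⟨b, rfl⟩ := cochainHyp_surjective f b
    exact ⟨diff _ q b, (diff_cochainHyp f b).symm, by rw [cochainL_diff, altDiff_altDiff]⟩

end Reduction

end

/-! ### Gradings and the action of Frobenius on degrees -/

section

open MvPolynomial

variable {k : Type u} [Field k] {n : ℕ}

section HomogeneousLaurent

/-- All monomials of `l` have degree `j`. -/
def IsHomL (j : ℤ) (l : Laurent k n) : Prop := ∀ z, l.coeff z ≠ 0 → ∑ i, z i = j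

/-- Every monomial of `l` has a nonnegative exponent, that is, `l` vanishes in `H^{n+1}_𝔪(R)`. -/
def IsTopBoundary (l : Laurent k n) : Prop := ∀ z, l.coeff z ≠ 0 → ∃ i, 0 ≤ z i

lemma sum_expInt (a : Fin (n + 1) →₀ ℕ) : ∑ i, expInt n a i = a.degree := by
  rw [Finsupp.degree_eq_sum]; push_cast; rfl

lemma sum_nsmul_indExp (N : ℕ) (I : Finset (Fin (n + 1))) :
    ∑ i, (N • indExp I) i = N * I.card := by
  simp only [nsmul_indExp_apply, Finset.sum_ite_mem, Finset.univ_inter, Finset.sum_const,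
    nsmul_eq_mul]
  ring

lemma isHomL_toL {g : Poly k n} {s : ℕ} (hg : g.IsHomogeneous s) : IsHomL s (toL k n g) := by
  intro z hz
  obtain ⟨a, rfl⟩ := exists_of_coeff_toL_ne_zero hz
  rw [sum_expInt, isHomogeneous_iff_degree.mp hg a (by rwa [← coeff_toL])]

lemma isHomogeneous_of_isHomL {g : Poly k n} {s : ℕ} (hg : IsHomL s (toL k n g)) :
    g.IsHomogeneous s := by
  rw [isHomogeneous_iff_degree]
  intro a ha
  have := hg (expInt n a) (by rwa [coeff_toL])
  rw [sum_expInt] at this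
  exact_mod_cast this

lemma IsHomL.mul_mono {j : ℤ} {l : Laurent k n} (h : IsHomL j l) (w : Fin (n + 1) → ℤ) :
    IsHomL (j + ∑ i, w i) (l * mono k w) := by
  intro z hz
  rw [coeff_mul_mono] at hz
  have := h _ hz
  simp only [Pi.sub_apply, Finset.sum_sub_distrib] at this
  omega

lemma coeff_add_ne_zero {l l' : Laurent k n} {z : Fin (n + 1) → ℤ} (h : (l + l').coeff z ≠ 0) :
    l.coeff z ≠ 0 ∨ l'.coeff z ≠ 0 := by
  by_contra! h'
  exact h (by rw [AddMonoidAlgebra.coeff_add, Finsupp.add_apply, h'.1, h'.2, add_zero])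

lemma IsHomL.add {j : ℤ} {l l' : Laurent k n} (h : IsHomL j l) (h' : IsHomL j l') :
    IsHomL j (l + l') := fun z hz => (coeff_add_ne_zero hz).elim (h z) (h' z)

lemma IsHomL.neg {j : ℤ} {l : Laurent k n} (h : IsHomL j l) : IsHomL j (-l) := fun z hz =>
  h z fun h0 => hz (by rw [AddMonoidAlgebra.coeff_neg, Finsupp.neg_apply, h0, neg_zero])

lemma isHomL_zero (j : ℤ) : IsHomL j (0 : Laurent k n) := fun _ hz => absurd rfl hz

lemma exists_of_coeff_mul_ne_zero {l l' : Laurent k n} {z : Fin (n + 1) → ℤ}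
    (h : (l * l').coeff z ≠ 0) : ∃ u v, u + v = z ∧ l.coeff u ≠ 0 ∧ l'.coeff v ≠ 0 := by
  classical
  rw [AddMonoidAlgebra.coeff_mul] at h
  obtain ⟨u, hu, h⟩ := Finset.exists_ne_zero_of_sum_ne_zero h
  obtain ⟨v, hv, h⟩ := Finset.exists_ne_zero_of_sum_ne_zero h
  refine ⟨u, v, ?_, Finsupp.mem_support_iff.mp hu, Finsupp.mem_support_iff.mp hv⟩
  by_contra huv
  exact h (if_neg huv)

lemma IsHomL.mul {i j : ℤ} {l l' : Laurent k n} (h : IsHomL i l) (h' : IsHomL j l') :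
    IsHomL (i + j) (l * l') := by
  intro z hz
  obtain ⟨u, v, rfl, hu, hv⟩ := exists_of_coeff_mul_ne_zero hz
  simp only [Pi.add_apply, Finset.sum_add_distrib, h u hu, h' v hv]

/-- The degree `j` part of a Laurent polynomial. -/
def homPart (j : ℤ) : Laurent k n →+ Laurent k n := trunc fun z => ∑ i, z i = j

lemma isHomL_homPart (j : ℤ) (l : Laurent k n) : IsHomL j (homPart j l) :=
  fun _ hz => (coeff_trunc_ne_zero hz).1

lemma homPart_eq_self {j : ℤ} {l : Laurent k n} (h : IsHomL j l) : homPart j l = l :=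
  trunc_eq_self h

/-- It allows the quotient of a homogeneous element by `f` to be replaced by a homogeneous one. -/
lemma homPart_mul {d j : ℤ} {a : Laurent k n} (ha : IsHomL d a) (l : Laurent k n) :
    homPart j (a * l) = a * homPart (j - d) l := by
  have h1 : homPart j (a * homPart (j - d) l) = a * homPart (j - d) l :=
    homPart_eq_self (by simpa using ha.mul (isHomL_homPart (j - d) l))
  have h2 : homPart j (a * (l - homPart (j - d) l)) = 0 := by
    ext z
    by_contra h
    obtain ⟨hz, h⟩ := coeff_trunc_ne_zero h
    obtain ⟨u, v, rfl, hu, hv⟩ := exists_of_coeff_mul_ne_zero h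
    simp only [Pi.add_apply, Finset.sum_add_distrib, ha u hu] at hz
    apply hv
    rw [AddMonoidAlgebra.coeff_sub, Finsupp.sub_apply, homPart, coeff_trunc,
      if_pos (by omega), sub_self]
  rw [mul_sub, map_sub, h1, sub_eq_zero] at h2
  exact h2

end HomogeneousLaurent

section LocDegree

variable (f : Poly k n)

lemma locHyp_eq_of_mul_eq {I : Finset (Fin (n + 1))} {z : Loc (polyVar k n) I} {N : ℕ}
    {g : Poly k n}
    (h : z * algebraMap _ _ (∏ i ∈ I, polyVar k n i) ^ N = algebraMap _ _ g) :
    locHyp f I z = Localization.mk (Ideal.Quotient.mk (Ideal.span {f}) g)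
      ⟨(∏ i ∈ I, hypVar f i) ^ N, pow_mem (Submonoid.mem_powers _) N⟩ := by
  have h1 := congrArg (locHyp f I) h
  rw [map_mul, map_pow, locHyp_algebraMap, locHyp_algebraMap, mk_prod_polyVar, ← map_pow] at h1
  rw [Localization.mk_eq_mk', IsLocalization.eq_mk'_iff_mul_eq]
  exact h1

/-- Together with `locHyp_mem_locDegree`, this makes `locDegree` the image of homogeneous Laurent
polynomials, so that degrees are read off exponents. -/
lemma exists_of_mem_locDegree {j : ℤ} {I : Finset (Fin (n + 1))} {y : Loc (hypVar f) I}
    (hy : y ∈ locDegree (hypVar f) (hypGrading f) j I) :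
    ∃ z, locHyp f I z = y ∧ IsHomL j (locL I z) := by
  induction hy using AddSubgroup.closure_induction with
  | mem y hy =>
    obtain ⟨N, r, _, ⟨g, hg, rfl⟩, hr, rfl⟩ := hy
    let z : Loc (polyVar k n) I :=
      Localization.mk g ⟨(∏ i ∈ I, polyVar k n i) ^ N, pow_mem (Submonoid.mem_powers _) N⟩
    have hz : z * algebraMap _ _ (∏ i ∈ I, polyVar k n i) ^ N = algebraMap _ _ g := by
      rw [← map_pow]
      simp only [z, Localization.mk_eq_mk']
      exact IsLocalization.mk'_spec _ g
        (⟨(∏ i ∈ I, polyVar k n i) ^ N, pow_mem (Submonoid.mem_powers _) N⟩ :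
          Submonoid.powers (∏ i ∈ I, polyVar k n i))
    refine ⟨z, locHyp_eq_of_mul_eq f hz, ?_⟩
    have h1 := congrArg (locL I) hz
    rw [map_mul, map_pow, locL_algebraMap, locL_algebraMap, toL_prod_X, mono_pow] at h1
    have h2 : locL I z = toL k n g * mono k (-(N • indExp I)) := by
      rw [← h1, mul_assoc, mono_mul_neg, mul_one]
    rw [h2]
    have h3 := (isHomL_toL (s := r) hg).mul_mono (-(N • indExp I))
    simp only [Pi.neg_apply, Finset.sum_neg_distrib, sum_nsmul_indExp] at h3
    rwa [hr, add_neg_cancel_right] at h3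
  | zero => exact ⟨0, map_zero _, by rw [map_zero]; exact isHomL_zero j⟩
  | add x y _ _ hx hy =>
    obtain ⟨z, rfl, hz⟩ := hx
    obtain ⟨w, rfl, hw⟩ := hy
    exact ⟨z + w, map_add _ _ _, by rw [map_add]; exact hz.add hw⟩
  | neg x _ hx =>
    obtain ⟨z, rfl, hz⟩ := hx
    exact ⟨-z, map_neg _ _, by rw [map_neg]; exact hz.neg⟩

lemma locHyp_mem_locDegree {j : ℤ} {I : Finset (Fin (n + 1))} {z : Loc (polyVar k n) I}
    (hz : IsHomL j (locL I z)) :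
    locHyp f I z ∈ locDegree (hypVar f) (hypGrading f) j I := by
  obtain ⟨N, g, h1, h2⟩ := exists_locL_mul_mono I z
  have h3 := hz.mul_mono (N • indExp I)
  rw [h2, sum_nsmul_indExp] at h3
  rw [locHyp_eq_of_mul_eq f h1]
  -- A generator of `locDegree` needs a natural number `r = j + N |I|`; only a monomial of `g`
  -- ensures that this integer is nonnegative.
  by_cases hg : g = 0
  · rw [hg, map_zero, Localization.mk_zero]
    exact AddSubgroup.zero_mem _
  · obtain ⟨a, ha⟩ := ne_zero_iff.mp hg
    have h4 := h3 (expInt n a) (by rwa [coeff_toL])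
    rw [sum_expInt] at h4
    rw [← h4] at h3
    exact AddSubgroup.subset_closure
      ⟨N, a.degree, _, ⟨g, isHomogeneous_of_isHomL h3, rfl⟩, h4, rfl⟩

end LocDegree

section FrobeniusDegree

variable {p : ℕ} [hp : Fact p.Prime] [CharP k p] (f : Poly k n)

lemma frob_mem_locDegree {j : ℤ} {I : Finset (Fin (n + 1))} {y : Loc (hypVar f) I}
    (hy : y ∈ locDegree (hypVar f) (hypGrading f) j I) :
    frob p _ (natCast_loc (hypVar f) p (natCast_hyp p f) I) y ∈
      locDegree (hypVar f) (hypGrading f) (p * j) I := by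
  induction hy using AddSubgroup.closure_induction with
  | mem y hy =>
    obtain ⟨N, r, _, ⟨g, hg, rfl⟩, hr, rfl⟩ := hy
    refine AddSubgroup.subset_closure ⟨N * p, r * p, Ideal.Quotient.mk _ (g ^ p),
      ⟨g ^ p, IsHomogeneous.pow hg p, rfl⟩, ?_, ?_⟩
    · push_cast
      rw [hr]; ring
    · change Localization.mk _ _ ^ p = _
      rw [Localization.mk_pow, map_pow]
      congr 1
      ext
      simp [pow_mul]
  | zero => rw [map_zero]; exact AddSubgroup.zero_mem _
  | add x y _ _ hx hy => rw [map_add]; exact AddSubgroup.add_mem _ hx hy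
  | neg x _ hx => rw [map_neg]; exact AddSubgroup.neg_mem _ hx

lemma hypFrob_mem_degree {q : ℕ} {j : ℤ} {ξ : HypLC f q} (hξ : ξ ∈ hypLCDegree f q j) :
    hypFrob p f q ξ ∈ hypLCDegree f q (p * j) := by
  obtain ⟨c, hc, rfl⟩ := hξ
  exact ⟨frobCocycles (hypVar f) p (natCast_hyp p f) q c,
    fun I => frob_mem_locDegree f (hc I), rfl⟩

lemma hypFrob_mapsTo (q : ℕ) (N : ℤ) :
    Set.MapsTo (hypFrob p f q) (hypLCLT f q N) (hypLCLT f q (p * N)) := by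
  intro ξ hξ
  have h0 : (0 : ℤ) < p := by exact_mod_cast hp.out.pos
  refine AddSubgroup.iSup_induction _
    (C := fun ξ => hypFrob p f q ξ ∈ hypLCLT f q (p * N)) hξ ?_ ?_ ?_
  · rintro ⟨j, hj⟩ ξ hξ
    exact AddSubgroup.mem_iSup_of_mem (⟨p * j, by nlinarith⟩ : {j : ℤ // j < p * N})
      (hypFrob_mem_degree f hξ)
  · rw [hypFrob, map_zero]; exact AddSubgroup.zero_mem _
  · intro x y hx hy
    rw [hypFrob, map_add]; exact AddSubgroup.add_mem _ hx hy

end FrobeniusDegree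

/-! ### The connecting homomorphism to `H^{n+1}_𝔪(R)` -/

section Connecting

variable (f : Poly k n)

/-- The class `ξ ∈ H^n_𝔪(R/fR)` is sent by the connecting homomorphism of
`0 → R → R → R/fR → 0` to the class of the Laurent polynomial `l`. -/
def IsConnecting (ξ : HypLC f n) (l : Laurent k n) : Prop :=
  ∃ (c : Cochain (polyVar k n) n) (h : cochainHyp f c ∈ cocycles (hypVar f) n),
    (Submodule.Quotient.mk ⟨cochainHyp f c, h⟩ : HypLC f n) = ξ ∧
      altDiff (cochainL c) Finset.univ = toL k n f * l

variable {f}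

lemma isConnecting_zero : IsConnecting f 0 0 := by
  refine ⟨0, by rw [map_zero]; exact Submodule.zero_mem _, ?_, ?_⟩
  · rw [Submodule.Quotient.mk_eq_zero]
    change cochainHyp f 0 ∈ coboundaries (hypVar f) n
    rw [map_zero]; exact Submodule.zero_mem _
  · have h4 : cochainL (0 : Cochain (polyVar k n) n) = 0 := by
      funext J; simp [cochainL]
    rw [h4, map_zero, mul_zero]; rfl

lemma IsConnecting.add {ξ ξ' : HypLC f n} {l l' : Laurent k n} (h : IsConnecting f ξ l)
    (h' : IsConnecting f ξ' l') : IsConnecting f (ξ + ξ') (l + l') := by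
  obtain ⟨c, hc, rfl, h1⟩ := h
  obtain ⟨c', hc', rfl, h1'⟩ := h'
  have h2 := map_add (cochainHyp f) c c'
  refine ⟨c + c', by rw [h2]; exact Submodule.add_mem _ hc hc', ?_, ?_⟩
  · rw [← Submodule.Quotient.mk_add]
    congr 1
    exact Subtype.ext h2
  · rw [cochainL_add, map_add, Pi.add_apply, h1, h1', mul_add]

lemma altDiff_cochainL_of_ne_univ (c : Cochain (polyVar k n) n) {J : Finset (Fin (n + 1))}
    (hJ : J ≠ Finset.univ) : altDiff (cochainL c) J = 0 := by
  rw [← cochainL_diff, cochainL_of_card_ne]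
  intro h
  exact hJ (Finset.eq_univ_of_card J (by rw [h, Fintype.card_fin]))

lemma altDiff_cochainL_univ (c : Cochain (polyVar k n) n) :
    altDiff (cochainL c) Finset.univ =
      locL Finset.univ (diff _ n c ⟨Finset.univ, by simp⟩) := by
  rw [← cochainL_diff, cochainL_of_card]

/-- The differential of a degree `n` cochain has a single component, at the set of all variables,
where every Laurent polynomial is available as a quotient by `f`. -/
lemma cochainHyp_mem_cocycles_iff (c : Cochain (polyVar k n) n) :
    cochainHyp f c ∈ cocycles (hypVar f) n ↔
      ∃ l, altDiff (cochainL c) Finset.univ = toL k n f * l := by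
  rw [cocycles, LinearMap.mem_ker, diff_cochainHyp]
  constructor
  · intro h
    obtain ⟨b, hb⟩ := exists_eq_smul_of_cochainHyp_eq_zero f h
    refine ⟨cochainL b Finset.univ, ?_⟩
    rw [← cochainL_diff, hb, cochainL_smul]
  · rintro ⟨l, hl⟩
    have h (J : {J : Finset (Fin (n + 1)) // J.card = n + 1}) :
        ∃ z : Loc (polyVar k n) J.1, diff _ n c J = f • z := by
      obtain ⟨J, hJ⟩ := J
      obtain rfl : J = Finset.univ := Finset.eq_univ_of_card J (by rw [hJ, Fintype.card_fin])
      obtain ⟨z, rfl⟩ := exists_locL_eq (I := Finset.univ) (l := l) (by simp)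
      refine ⟨z, locL_injective _ ?_⟩
      rw [← altDiff_cochainL_univ, hl, Algebra.smul_def, map_mul, locL_algebraMap]
    choose b hb using h
    have : diff _ n c = f • b := funext hb
    rw [this, cochainHyp_smul]

/-- Boundaries of top degree are the Laurent polynomials without negative monomials. -/
lemma exists_altDiff_univ_eq {l : Laurent k n} (hl : IsTopBoundary l) :
    ∃ c : Cochain (polyVar k n) n, altDiff (cochainL c) Finset.univ = l := by
  classical
  let γ : Finset (Fin (n + 1)) → Laurent k n := fun J => if J = Finset.univ then l else 0
  have hγ (J) (h : J ≠ Finset.univ) : γ J = 0 := if_neg h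
  obtain ⟨η, h1, h2, h3⟩ := exists_altDiff_eq (q := n + 1) (γ := γ) (by
      intro J z hz j hj
      rw [hγ J (by rintro rfl; simp at hj)] at hz
      exact absurd rfl hz)
    (fun J hJ => hγ J (by rintro rfl; simp at hJ)) (by
      funext J
      rw [altDiff_apply, Finset.sum_eq_zero]
      · rfl
      · intro j _
        rw [hγ, smul_zero]
        intro h
        have := Finset.mem_univ j
        rw [← h] at this
        simp at this)
    (by
      intro J z hz
      by_cases hJ : J = Finset.univ
      · simp only [γ, if_pos hJ] at hz
        exact hl z hz
      · rw [hγ J hJ] at hz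
        exact absurd rfl hz)
  obtain ⟨c, rfl⟩ := exists_cochainL_eq h1 (q := n) fun J hJ => h2 J (by omega)
  exact ⟨c, by rw [h3]; exact if_pos rfl⟩

/-- Each summand of the top differential comes from a localization omitting one variable, whose
exponent is then nonnegative. -/
lemma isTopBoundary_altDiff_univ {q : ℕ} (c : Cochain (polyVar k n) q) :
    IsTopBoundary (altDiff (cochainL c) Finset.univ) := by
  intro z hz
  obtain ⟨j, -, hj⟩ := altDiff_coeff_ne_zero hz
  exact ⟨j, isLocFamily_cochainL c _ z hj j (by simp)⟩

/-- The connecting homomorphism is injective and well-defined. -/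
lemma IsConnecting.eq_zero_iff (hf : f ≠ 0) {ξ : HypLC f n} {l : Laurent k n}
    (h : IsConnecting f ξ l) : ξ = 0 ↔ IsTopBoundary l := by
  obtain ⟨c, hc, rfl, h1⟩ := h
  rw [Submodule.Quotient.mk_eq_zero]
  change cochainHyp f c ∈ coboundaries (hypVar f) n ↔ _
  have hf' : toL k n f ≠ 0 := fun h => hf (toL_injective (by rw [h, map_zero]))
  constructor
  · intro hb
    obtain ⟨b, hb1, hb2⟩ := exists_of_mem_coboundaries f hb
    obtain ⟨e, he⟩ := exists_eq_smul_of_cochainHyp_eq_zero f (c := c - b) (by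
      rw [map_sub, hb1, sub_self])
    -- With `b` a cocycle of `R`, the differential of `c` is `f` times that of `e`; cancelling `f`
    -- identifies `l` with a boundary.
    have h2 : c = b + f • e := by rw [← he]; abel
    have h3 : cochainL (f • e) = fun J => toL k n f * cochainL e J := funext (cochainL_smul f e)
    rw [h2, cochainL_add, map_add, hb2, zero_add, h3] at h1
    have h4 := map_altDiff (AddMonoidHom.mulLeft (toL k n f)) (cochainL e) Finset.univ
    simp only [AddMonoidHom.coe_mulLeft] at h4
    rw [← h4] at h1
    rw [← mul_left_cancel₀ hf' h1]
    exact isTopBoundary_altDiff_univ e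
  · intro hl
    -- With `l` the boundary of `e`, the cochain `c - f e` has the same reduction and is a cocycle
    -- of `R`, hence a coboundary by vanishing in degree `n`.
    obtain ⟨e, he⟩ := exists_altDiff_univ_eq hl
    have h3 : cochainL (f • e) = fun J => toL k n f * cochainL e J := funext (cochainL_smul f e)
    have h4 (J) := map_altDiff (AddMonoidHom.mulLeft (toL k n f)) (cochainL e) J
    simp only [AddMonoidHom.coe_mulLeft] at h4
    have h5 : cochainL c = cochainL (c - f • e) + cochainL (f • e) := by
      rw [← cochainL_add, sub_add_cancel]
    have h6 : altDiff (cochainL (c - f • e)) = 0 := by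
      funext J
      by_cases hJ : J = Finset.univ
      · have := congrFun (congrArg altDiff h5) J
        rw [map_add, Pi.add_apply, h3, ← h4, hJ, he, h1] at this
        rw [hJ]
        exact left_eq_add.mp (by rw [add_comm]; exact this)
      · exact altDiff_cochainL_of_ne_univ _ hJ
    have h7 := cochainHyp_mem_coboundaries f (mem_coboundaries_of_altDiff_eq_zero le_rfl h6)
    rwa [map_sub, cochainHyp_smul, sub_zero] at h7

variable (f) in
lemma exists_cochain_of_mem_locDegree {q : ℕ} {j : ℤ} (c' : Cochain (hypVar f) q)
    (h : ∀ I, c' I ∈ locDegree (hypVar f) (hypGrading f) j I.1) :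
    ∃ c : Cochain (polyVar k n) q, cochainHyp f c = c' ∧ ∀ J, IsHomL j (cochainL c J) := by
  have h' (I : {I : Finset (Fin (n + 1)) // I.card = q}) :
      ∃ z, locHyp f I.1 z = c' I ∧ IsHomL j (locL I.1 z) := exists_of_mem_locDegree f (h I)
  refine ⟨fun I => (h' I).choose, funext fun I => (h' I).choose_spec.1, fun J => ?_⟩
  by_cases hJ : J.card = q
  · rw [cochainL_of_card _ hJ]; exact (h' ⟨J, hJ⟩).choose_spec.2
  · rw [cochainL_of_card_ne _ hJ]; exact isHomL_zero j

/-- A homogeneous lift has a differential homogeneous of degree `j`, so its quotient by `f` may be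
replaced by the part of degree `j - d`. -/
lemma exists_isConnecting_of_mem_degree {d : ℕ} (hf : f.IsHomogeneous d) {ξ : HypLC f n} {j : ℤ}
    (hξ : ξ ∈ hypLCDegree f n j) : ∃ l, IsConnecting f ξ l ∧ IsHomL (j - d) l := by
  obtain ⟨⟨c', hc'⟩, hdeg, rfl⟩ := hξ
  obtain ⟨c, rfl, hc⟩ := exists_cochain_of_mem_locDegree f c' hdeg
  obtain ⟨l, hl⟩ := (cochainHyp_mem_cocycles_iff c).mp hc'
  refine ⟨homPart (j - d) l, ⟨c, hc', rfl, ?_⟩, isHomL_homPart _ l⟩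
  rw [← homPart_mul (isHomL_toL hf), ← hl, homPart_eq_self]
  intro z hz
  obtain ⟨i, -, hi⟩ := altDiff_coeff_ne_zero hz
  exact hc _ z hi

/-- The hypothesis `hfl` says that `f` kills the class of `l` in `H^{n+1}_𝔪(R)`, which describes the
image of the connecting homomorphism. -/
lemma exists_mem_degree_isConnecting {d : ℕ} (hf : f.IsHomogeneous d) {l : Laurent k n} {j : ℤ}
    (hl : IsHomL (j - d) l) (hfl : IsTopBoundary (toL k n f * l)) :
    ∃ ξ ∈ hypLCDegree f n j, IsConnecting f ξ l := by
  obtain ⟨c₀, hc₀⟩ := exists_altDiff_univ_eq hfl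
  obtain ⟨c, hc⟩ := exists_cochainL_eq (q := n) (γ := fun J => homPart j (cochainL c₀ J))
    (fun J z hz => isLocFamily_cochainL c₀ J z (coeff_trunc_ne_zero hz).2)
    (fun J hJ => by rw [cochainL_of_card_ne c₀ hJ, map_zero])
  have h1 : altDiff (cochainL c) Finset.univ = toL k n f * l := by
    rw [hc, ← map_altDiff, hc₀, homPart_mul (isHomL_toL hf), homPart_eq_self hl]
  have h2 : cochainHyp f c ∈ cocycles (hypVar f) n := (cochainHyp_mem_cocycles_iff c).mpr ⟨l, h1⟩
  refine ⟨Submodule.Quotient.mk ⟨_, h2⟩, ⟨⟨_, h2⟩, fun I => ?_, rfl⟩, c, h2, rfl, h1⟩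
  refine locHyp_mem_locDegree f ?_
  rw [← cochainL_of_card c I.2, hc]
  exact isHomL_homPart _ _

lemma exists_isConnecting_of_mem_LT {d : ℕ} (hf : f.IsHomogeneous d) {ξ : HypLC f n} {N : ℤ}
    (hξ : ξ ∈ hypLCLT f n N) :
    ∃ l, IsConnecting f ξ l ∧ ∀ z, l.coeff z ≠ 0 → ∑ i, z i < N - d := by
  refine AddSubgroup.iSup_induction _ (C := fun ξ => ∃ l, IsConnecting f ξ l ∧
    ∀ z, l.coeff z ≠ 0 → ∑ i, z i < N - d) hξ ?_ ?_ ?_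
  · rintro ⟨j, hj⟩ ξ hξ
    obtain ⟨l, h1, h2⟩ := exists_isConnecting_of_mem_degree hf hξ
    refine ⟨l, h1, fun z hz => ?_⟩
    rw [h2 z hz]
    exact sub_lt_sub_right hj _
  · exact ⟨0, isConnecting_zero, fun z hz => absurd rfl hz⟩
  · rintro x y ⟨l, h1, h2⟩ ⟨l', h1', h2'⟩
    exact ⟨l + l', h1.add h1', fun z hz => (coeff_add_ne_zero hz).elim (h2 z) (h2' z)⟩

variable {p : ℕ} [hp : Fact p.Prime] [CharP k p]

omit [CharP k p] in
lemma cochainL_frobCochain (hR : (p : Poly k n) = 0) {q : ℕ} (c : Cochain (polyVar k n) q)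
    (J : Finset (Fin (n + 1))) :
    cochainL (frobCochain (polyVar k n) p hR q c) J = cochainL c J ^ p := by
  by_cases hJ : J.card = q
  · rw [cochainL_of_card _ hJ, cochainL_of_card _ hJ, ← map_pow]; rfl
  · rw [cochainL_of_card_ne _ hJ, cochainL_of_card_ne _ hJ, zero_pow hp.out.ne_zero]

/-- The `p`-th power commutes with the Čech differential, and `(f l)^p = f · (f^{p-1} l^p)`. -/
lemma IsConnecting.hypFrob {ξ : HypLC f n} {l : Laurent k n} (h : IsConnecting f ξ l) :
    IsConnecting f (hypFrob p f n ξ) (toL k n f ^ (p - 1) * l ^ p) := by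
  obtain ⟨c, hc, rfl, h1⟩ := h
  have hR : (p : Poly k n) = 0 := CharP.cast_eq_zero _ _
  have h2 : cochainHyp f (frobCochain (polyVar k n) p hR n c) =
      frobCochain (hypVar f) p (natCast_hyp p f) n (cochainHyp f c) := by
    funext I
    exact map_pow (locHyp f I.1) (c I) p
  refine ⟨frobCochain (polyVar k n) p hR n c, ?_, ?_, ?_⟩
  · rw [h2]
    exact frobCochain_mem_cocycles (hypVar f) p (natCast_hyp p f) n ⟨_, hc⟩
  · change _ = Submodule.Quotient.mk (frobCocycles (hypVar f) p (natCast_hyp p f) n ⟨_, hc⟩)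
    congr 1
    exact Subtype.ext h2
  · rw [← cochainL_diff, diff_frobCochain, cochainL_frobCochain, cochainL_diff, h1, mul_pow,
      ← mul_assoc, mul_pow_sub_one hp.out.ne_zero]

end Connecting

end

/-! ### The kernel of Frobenius and the two statements -/

section

open MvPolynomial

variable {k : Type u} [Field k] {n p : ℕ} [hp : Fact p.Prime] [CharP k p]

/-- The fraction `g / (x₀ ⋯ xₙ) ^ q`. -/
def fracL (g : Poly k n) (q : ℕ) : Laurent k n := toL k n g * mono k (-fun _ => (q : ℤ))

omit hp [CharP k p] in
lemma coeff_fracL (g : Poly k n) (q : ℕ) (z : Fin (n + 1) → ℤ) :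
    (fracL g q).coeff z = (toL k n g).coeff (z + fun _ => (q : ℤ)) := by
  rw [fracL, coeff_mul_mono, sub_neg_eq_add]

omit hp [CharP k p] in
lemma coeff_fracL_sub (g : Poly k n) (q : ℕ) (a : Fin (n + 1) →₀ ℕ) :
    (fracL g q).coeff (expInt n a - fun _ => (q : ℤ)) = coeff a g := by
  rw [coeff_fracL, sub_add_cancel, coeff_toL]

/-- The exponent of `x_i` in `x^a / (x₀ ⋯ xₙ)^{p^e}` is nonnegative exactly when `a i ≥ p^e`. -/
lemma isTopBoundary_fracL_iff (g : Poly k n) (e : ℕ) :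
    IsTopBoundary (fracL g (p ^ e)) ↔ g ∈ frobPower p (maxIdeal k n) e := by
  rw [mem_frobPower_maxIdeal]
  constructor
  · intro h a ha
    obtain ⟨i, hi⟩ := h (expInt n a - fun _ => ((p ^ e : ℕ) : ℤ)) (by rwa [coeff_fracL_sub])
    refine ⟨i, ?_⟩
    rw [Pi.sub_apply, expInt_apply] at hi
    omega
  · intro h z hz
    rw [coeff_fracL] at hz
    obtain ⟨a, ha⟩ := exists_of_coeff_toL_ne_zero hz
    rw [← ha, coeff_toL] at hz
    obtain ⟨i, hi⟩ := h a hz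
    have := congrFun ha i
    rw [expInt_apply, Pi.add_apply] at this
    exact ⟨i, by omega⟩

omit [CharP k p] in
lemma exists_fracL_eq (l : Laurent k n) :
    ∀ᶠ e in Filter.atTop, ∃ g : Poly k n, fracL g (p ^ e) = l := by
  obtain ⟨N, hN⟩ := exists_nat_bound l
  rw [Filter.eventually_atTop]
  refine ⟨N, fun e he => ?_⟩
  have hle : N ≤ p ^ e := he.trans (Nat.lt_pow_self hp.out.one_lt).le
  obtain ⟨g, hg⟩ := exists_toL_eq (l := l * mono k (fun _ => ((p ^ e : ℕ) : ℤ))) (by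
    intro w hw i
    rw [coeff_mul_mono] at hw
    have := hN _ hw i
    rw [Pi.sub_apply] at this
    omega)
  exact ⟨g, by rw [fracL, hg, mul_assoc, mono_mul_neg, mul_one]⟩

variable {ι : Type} [Fintype ι] (B : FrobCoord p (Poly k n) ι) {f : Poly k n}
include B

/-- The kernel of Frobenius on `H^n_𝔪(R/fR)` is the annihilator of `τ` in `H^{n+1}_𝔪(R)`. -/
lemma FrobCoord.hypFrob_eq_zero_iff (hf0 : f ≠ 0) {ξ : HypLC f n} {g : Poly k n} {e : ℕ}
    (h : IsConnecting f ξ (fracL g (p ^ e))) :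
    hypFrob p f n ξ = 0 ↔
      g ∈ (frobPower p (maxIdeal k n) e).colon (testIdeal p f 1 : Set (Poly k n)) := by
  have h1 : toL k n f ^ (p - 1) * fracL g (p ^ e) ^ p =
      fracL (f ^ (p - 1) * g ^ p) (p ^ (e + 1)) := by
    rw [fracL, fracL, mul_pow, mono_pow, map_mul, map_pow, map_pow, mul_assoc]
    congr 3
    funext i
    simp [pow_succ, mul_comm]
  have h2 := h.hypFrob (p := p)
  rw [h1] at h2
  -- Vanishing means `f^{p-1} g^p ∈ 𝔪^{[p^{e+1}]}`; reading this as `(𝔪^{[p^e]})^{[p]}` turns it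
  -- into `g τ ⊆ 𝔪^{[p^e]}`.
  rw [h2.eq_zero_iff hf0, isTopBoundary_fracL_iff, ← B.pow_mul_pow_mem_iff, frobPower_frobPower]

variable (hB : ∀ i (g : Poly k n) (D : ℕ), g.IsHomogeneous D → ∃ D', (B.coord i g).IsHomogeneous D')
  {d : ℕ} (hf : f.IsHomogeneous d) {δ : ℤ}
include hf

include hB in
-- All components of the numerator `g` multiply `τ` into `𝔪^{[p^e]}`. One outside `𝔪^{[p^e]}` would
-- have degree at least `δ + (n+1) p^e`, whereas the monomials of the fraction have degree below
-- `δ`.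
lemma FrobCoord.eq_zero_of_hypFrob_eq_zero (hf0 : f ≠ 0) (hδ : IsMinShift p f δ) {ξ : HypLC f n}
    (hξ : ξ ∈ hypLCLT f n (δ + d)) (h0 : hypFrob p f n ξ = 0) : ξ = 0 := by
  obtain ⟨l, h1, h2⟩ := exists_isConnecting_of_mem_LT hf hξ
  obtain ⟨e, g, rfl⟩ := (exists_fracL_eq (p := p) l).exists
  rw [B.hypFrob_eq_zero_iff hf0 h1] at h0
  rw [h1.eq_zero_iff hf0, isTopBoundary_fracL_iff, ← sum_homogeneousComponent g]
  refine Ideal.sum_mem _ fun s _ => ?_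
  by_contra hs
  have h3 := hδ.1 e s ⟨_, homogeneousComponent_isHomogeneous s g,
    B.homogeneousComponent_mem_colon hB hf h0 s, hs⟩
  rw [mem_frobPower_maxIdeal] at hs
  push Not at hs
  obtain ⟨a, ha, -⟩ := hs
  rw [coeff_homogeneousComponent] at ha
  split_ifs at ha with has
  swap
  · exact ha rfl
  have h4 := h2 _ (by rwa [coeff_fracL_sub])
  simp only [Pi.sub_apply, Finset.sum_sub_distrib, sum_expInt, has, Finset.sum_const,
    Finset.card_univ, Fintype.card_fin, nsmul_eq_mul, add_sub_cancel_right] at h4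
  push_cast at h4
  linarith

include hB in
lemma FrobCoord.injOn_hypFrob (hf0 : f ≠ 0) (hδ : IsMinShift p f δ) :
    Set.InjOn (hypFrob p f n) (hypLCLT f n (δ + d)) := by
  intro x hx y hy hxy
  rw [← sub_eq_zero]
  refine B.eq_zero_of_hypFrob_eq_zero hB hf hf0 hδ (AddSubgroup.sub_mem _ hx hy) ?_
  rw [hypFrob, map_sub, sub_eq_zero]
  exact hxy

/-- A minimal `g` gives a class killed by `τ`. As `f ∈ τ`, it is killed by `f` and so comes from
`H^n_𝔪(R/fR)`. -/
lemma FrobCoord.exists_hypFrob_eq_zero (hf0 : f ≠ 0) (hδ : IsMinShift p f δ) :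
    ∃ ξ ∈ hypLCDegree f n (δ + d), ξ ≠ 0 ∧ hypFrob p f n ξ = 0 := by
  obtain ⟨e, s, ⟨g, hg, hcolon, hmem⟩, hs⟩ := hδ.2.exists
  have h1 : IsHomL (δ + d - d) (fracL g (p ^ e)) := by
    have := (isHomL_toL hg).mul_mono (-fun _ => ((p ^ e : ℕ) : ℤ))
    simp only [Pi.neg_apply, Finset.sum_neg_distrib, Finset.sum_const,
      Finset.card_univ, Fintype.card_fin, nsmul_eq_mul] at this
    rw [← hs, fracL]
    convert this using 1
    push_cast
    ring
  have h2 : IsTopBoundary (toL k n f * fracL g (p ^ e)) := by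
    have h3 : g * f ∈ frobPower p (maxIdeal k n) e :=
      Submodule.mem_colon.mp hcolon f (B.self_mem_testIdeal f)
    rwa [mul_comm, ← isTopBoundary_fracL_iff, fracL, map_mul, mul_assoc] at h3
  obtain ⟨ξ, hξ, hcon⟩ := exists_mem_degree_isConnecting hf h1 h2
  refine ⟨ξ, hξ, ?_, (B.hypFrob_eq_zero_iff hf0 hcon).mpr hcolon⟩
  rwa [Ne, hcon.eq_zero_iff hf0, isTopBoundary_fracL_iff]

include hB in
lemma FrobCoord.exists_isMinShift_of_isolated (hiso : IsolatedNonFPure p f) :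
    f ≠ 0 ∧ ∃ δ, IsMinShift p f δ := by
  obtain ⟨hm, hP⟩ := hiso
  have hf0 : f ≠ 0 := by
    rintro rfl
    exact hm (B.isFPure_hypLoc_zero _)
  rw [B.isFPure_hypLoc_iff hf0, not_not] at hm
  obtain ⟨N, hN⟩ := B.exists_maxIdeal_pow_le hB hf
    fun P _ h => (B.isFPure_hypLoc_iff hf0 P).mp (hP P h)
  exact ⟨hf0, exists_isMinShift hN hm⟩

omit hf in
lemma FrobCoord.isolatedNonFPure_of_testIdeal_eq {j : ℕ} (hj : 1 ≤ j)
    (h : testIdeal p f 1 = maxIdeal k n ^ j) : f ≠ 0 ∧ IsolatedNonFPure p f := by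
  have hf0 : f ≠ 0 := by
    rintro rfl
    have h1 : testIdeal p (0 : Poly k n) 1 = ⊥ := by
      rw [B.testIdeal_eq, zero_pow (Nat.sub_pos_of_lt hp.out.one_lt).ne']
      simp
    have h2 : (X 0 : Poly k n) ^ j ∈ maxIdeal k n ^ j :=
      Ideal.pow_mem_pow (Ideal.subset_span (Set.mem_range_self 0)) j
    rw [← h, h1, Ideal.mem_bot] at h2
    exact X_ne_zero (R := k) (0 : Fin (n + 1)) (pow_eq_zero_iff (by omega) |>.mp h2)
  refine ⟨hf0, ?_, fun P _ hP => ?_⟩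
  · rw [B.isFPure_hypLoc_iff hf0, not_not, h]
    exact Ideal.pow_le_self (by omega)
  · rw [B.isFPure_hypLoc_iff hf0, h]
    exact fun hle => hP.not_ge (Ideal.IsPrime.le_of_pow_le hle)

end

end FPureHyp

end

theorem theorem2 {k : Type*} [Field k] (p : ℕ) [Fact p.Prime] [CharP k p]
    (hk : (frobenius k p).Finite) (n d : ℕ) (f : FPureHyp.Poly k n) (hf : f.IsHomogeneous d) :
    (FPureHyp.IsolatedNonFPure p f →
      ∃ δ : ℤ, FPureHyp.IsDelta p f δ ∧
        Set.MapsTo (FPureHyp.hypFrob p f n)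
          (FPureHyp.hypLCLT f n (δ + d)) (FPureHyp.hypLCLT f n (p * (δ + d))) ∧
        Set.InjOn (FPureHyp.hypFrob p f n) (FPureHyp.hypLCLT f n (δ + d)) ∧
        ∃ ξ ∈ FPureHyp.hypLCDegree f n (δ + d), ξ ≠ 0 ∧ FPureHyp.hypFrob p f n ξ = 0) ∧
    (∀ j : ℕ, 1 ≤ j → FPureHyp.testIdeal p f 1 = FPureHyp.maxIdeal k n ^ j →
      FPureHyp.IsolatedNonFPure p f ∧
        FPureHyp.IsDelta p f (-n - j) ∧
        Set.MapsTo (FPureHyp.hypFrob p f n)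
          (FPureHyp.hypLCLT f n (-n - j + d)) (FPureHyp.hypLCLT f n (p * (-n - j + d))) ∧
        Set.InjOn (FPureHyp.hypFrob p f n) (FPureHyp.hypLCLT f n (-n - j + d))) := by
  obtain ⟨ι, _, B, hB⟩ := FPureHyp.exists_frobCoord p hk n
  refine ⟨fun hiso => ?_, fun j hj hτ => ?_⟩
  · obtain ⟨hf0, δ, hδ⟩ := B.exists_isMinShift_of_isolated hB hf hiso
    exact ⟨δ, hδ.isDelta, FPureHyp.hypFrob_mapsTo f n _, B.injOn_hypFrob hB hf hf0 hδ,
      B.exists_hypFrob_eq_zero hf hf0 hδ⟩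
  · obtain ⟨hf0, hiso⟩ := B.isolatedNonFPure_of_testIdeal_eq hj hτ
    have hδ := FPureHyp.isMinShift_of_testIdeal_eq hj hτ
    exact ⟨hiso, hδ.isDelta, FPureHyp.hypFrob_mapsTo f n _, B.injOn_hypFrob hB hf hf0 hδ⟩
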